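/- **Conventions.** A *surface* is a connected (Hausdorff, second countable) smooth $2$-manifold $M$ with a smooth connection $\nabla$ on $TM$, possibly with torsion. In a chart write $\nabla_{\partial_i}\partial_j=\Gamma_{ij}{}^k\partial_k$ and $$R_{ijk}{}^l=\partial_i\Gamma_{jk}{}^l-\partial_j\Gamma_{ik}{}^l+\Gamma_{in}{}^l\Gamma_{jk}{}^n-\Gamma_{jn}{}^l\Gamma_{ik}{}^n,\qquad \rho_{jk}=R_{ijk}{}^i,\qquad \rho_{s,jk}=\tfrac12(\rho_{jk}+\rho_{kj}).$$ The surface is *of Type $\mathcal A$* if it is covered by smooth charts in each of which the Christoffel symbols $\Gamma_{ij}{}^k$ are constant; such a chart is a *Type $\mathcal A$ chart*. A symmetric bilinear form has signature $(p,q)$ if it is non-degenerate with $p$ negative and $q$ positive directions. Let $p+q=2$. Let $\mathcal W(p,q)\subset\mathbb R^8$ be the set of constant Christoffel symbols $\Gamma=(\Gamma_{ij}{}^k)$ whose symmetric Ricci tensor $\rho_s$ is non-degenerate of signature $(p,q)$, and let $\mathcal Z(p,q)\subset\mathcal W(p,q)$ be the torsion-free ones, i.e. those with $\Gamma_{ij}{}^k=\Gamma_{ji}{}^k$.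 The group $\mathrm{GL}(2,\mathbb R)$, and its subgroup $\mathrm{GL}^+(2,\mathbb R)$ of matrices of positive determinant, act on both sets by linear change of coordinates, $(g\Gamma)_{ij}{}^k=(g^{-1})^a_i(g^{-1})^b_j\,g^k_c\,\Gamma_{ab}{}^c$. Two surfaces $M,N$ are *locally isomorphic* if for all $P\in M$ and $Q\in N$ there is a germ of a diffeomorphism taking $P$ to $Q$ and the connection of $M$ to that of $N$; for oriented surfaces the germs are required to preserve the orientation. Let $\mathfrak W(p,q)$ (resp. $\mathfrak W^+(p,q)$) be the moduli space of unoriented (resp. oriented) Type $\mathcal A$ surfaces whose symmetric Ricci tensor is everywhere non-degenerate of signature $(p,q)$, modulo (oriented) local isomorphism; let $\mathfrak Z(p,q)$ and $\mathfrak Z^+(p,q)$ be the corresponding moduli spaces of torsion-free surfaces. **Theorem.** In each of the four cases (oriented) local isomorphism is an equivalence relation on the structures considered, and $$\mathfrak Z^+(p,q)=\mathcal Z(p,q)/\mathrm{GL}^+(2,\mathbb R),\qquad \mathfrak W^+(p,q)=\mathcal W(p,q)/\mathrm{GL}^+(2,\mathbb R),$$ $$\mathfrak Z(p,q)=\mathcal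 Z(p,q)/\mathrm{GL}(2,\mathbb R),\qquad \mathfrak W(p,q)=\mathcal W(p,q)/\mathrm{GL}(2,\mathbb R).$$ Here "$=$" means that there is a bijection which sends the class of a surface $M$ to the orbit of $\Gamma$ whenever $M$ has a Type $\mathcal A$ chart (positively oriented in the oriented cases) with non-empty domain and Christoffel symbols $\Gamma$; in particular such a $\Gamma$ lies in $\mathcal W(p,q)$, and in $\mathcal Z(p,q)$ in the torsion-free cases. -/

import Mathlib

open scoped Manifold ContDiff

/-- The coordinate plane. -/
abbrev Plane : Type := EuclideanSpace ℝ (Fin 2)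

/-- Arrays of Christoffel symbols `Γ i j k`, standing for `Γ_{ij}{}^k` in
`∇_{∂_i} ∂_j = ∑ k, Γ_{ij}{}^k ∂_k`; this is a copy of `ℝ⁸`. -/
def Christoffel : Type := Fin 2 → Fin 2 → Fin 2 → ℝ

/-! ### Curvature and Ricci tensor in coordinates -/

/-- The partial derivative `∂_i f` at `y`. -/
noncomputable def partialDeriv (i : Fin 2) (f : Plane → ℝ) (y : Plane) : ℝ :=
  fderiv ℝ f y (EuclideanSpace.single i 1)

/-- The component `R_{ijk}{}^l` at `y` of the curvature operator of the connection whose Christoffel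
symbols are the functions `G`. -/
noncomputable def curvature (G : Plane → Christoffel) (y : Plane) (i j k l : Fin 2) : ℝ :=
  partialDeriv i (fun z => G z j k l) y - partialDeriv j (fun z => G z i k l) y
    + ∑ n, G y i n l * G y j k n - ∑ n, G y j n l * G y i k n

/-- The Ricci tensor `ρ_{jk} = ∑ i, R_{ijk}{}^i`, that is `ρ(x, y) = Tr (z ↦ R(z, x) y)`. -/
noncomputable def ricci (G : Plane → Christoffel) (y : Plane) : Matrix (Fin 2) (Fin 2) ℝ :=
  Matrix.of fun j k => ∑ i, curvature G y i j k i

/-- The symmetric Ricci tensor `ρ_s`. -/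
noncomputable def symRicci (G : Plane → Christoffel) (y : Plane) : Matrix (Fin 2) (Fin 2) ℝ :=
  (1 / 2 : ℝ) • (ricci G y + (ricci G y).transpose)

/-- The symmetric bilinear form with matrix `B` is non-degenerate, of signature `(p, q)`: it has `p`
negative and `q` positive directions. -/
def HasSignature (B : Matrix (Fin 2) (Fin 2) ℝ) (p q : ℕ) : Prop :=
  B.det ≠ 0 ∧ sigNeg B.toQuadraticForm' = p ∧
    sigPos B.toQuadraticForm' = q

/-! ### The action of the general linear group on Christoffel symbols -/

/-- The group `GL(2, ℝ)`. -/
abbrev GLTwo : Type := Matrix.GeneralLinearGroup (Fin 2) ℝ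

/-- The subgroup `GL⁺(2, ℝ)` of matrices with positive determinant. -/
noncomputable abbrev GLTwoPos : Subgroup GLTwo := Matrix.GLPos (Fin 2) ℝ

/-- `GL(2, ℝ)` acts on Christoffel symbols by linear changes of coordinates:
`(g Γ)_{ij}{}^k = ∑ a b c, (g⁻¹)^a_i (g⁻¹)^b_j g^k_c Γ_{ab}{}^c`. -/
noncomputable instance Christoffel.instSMul : SMul GLTwo Christoffel where
  smul g Γ := fun i j k => ∑ a, ∑ b, ∑ c,
    (g⁻¹ : GLTwo) a i * (g⁻¹ : GLTwo) b j * g k c * Γ a b c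

theorem Christoffel.smul_apply (g : GLTwo) (Γ : Christoffel) (i j k : Fin 2) :
    (g • Γ) i j k = ∑ a, ∑ b, ∑ c,
      (g⁻¹ : GLTwo) a i * (g⁻¹ : GLTwo) b j * g k c * Γ a b c := rfl

noncomputable instance Christoffel.instMulAction : MulAction GLTwo Christoffel where
  one_smul Γ := by
    funext i j k
    rw [Christoffel.smul_apply]
    simp [Matrix.one_apply]
  mul_smul g h Γ := by
    funext i j k
    simp only [Christoffel.smul_apply, mul_inv_rev, Units.val_mul, Matrix.mul_apply,
      Fin.sum_univ_two]
    ring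

/-- `𝒲(p, q)`: the Christoffel symbols of the constant-coefficient connections on `ℝ²` whose
symmetric Ricci tensor is non-degenerate of signature `(p, q)`. -/
def Christoffel.W (p q : ℕ) : Set Christoffel :=
  {Γ | HasSignature (symRicci (fun _ => Γ) 0) p q}

/-- `𝒵(p, q)`: the elements of `𝒲(p, q)` that define a torsion-free connection. -/
def Christoffel.Z (p q : ℕ) : Set Christoffel :=
  {Γ | Γ ∈ Christoffel.W p q ∧ ∀ i j k, Γ i j k = Γ j i k}


theorem partialDeriv_const (i : Fin 2) (c : ℝ) (y : Plane) :
    partialDeriv i (fun _ => c) y = 0 := by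
  simp [partialDeriv]

theorem curvature_const_smul (g : GLTwo) (Γ : Christoffel) (y : Plane) (i j k l : Fin 2) :
    curvature (fun _ => g • Γ) y i j k l = ∑ a, ∑ b, ∑ m, ∑ n,
      (g⁻¹ : GLTwo) a i * (g⁻¹ : GLTwo) b j * (g⁻¹ : GLTwo) n k * g l m *
        curvature (fun _ => Γ) y a b n m := by
  have h : ((g⁻¹ : GLTwo) : Matrix (Fin 2) (Fin 2) ℝ) * (g : Matrix (Fin 2) (Fin 2) ℝ) = 1 := by
    rw [← Units.val_mul, inv_mul_cancel, Units.val_one]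
  have h0 := congrFun (congrFun h 0) 0
  have h1 := congrFun (congrFun h 0) 1
  have h2 := congrFun (congrFun h 1) 0
  have h3 := congrFun (congrFun h 1) 1
  simp only [Matrix.mul_apply, Fin.sum_univ_two, Matrix.one_apply_eq, Matrix.one_apply_ne, ne_eq,
    zero_ne_one, one_ne_zero, not_false_eq_true] at h0 h1 h2 h3
  have key : ∀ i j k l, ∑ n, (g • Γ) i n l * (g • Γ) j k n = ∑ a, ∑ b, ∑ m, ∑ n,
      (g⁻¹ : GLTwo) a i * (g⁻¹ : GLTwo) b j * (g⁻¹ : GLTwo) n k * g l m *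
        ∑ s, Γ a s m * Γ b n s := by
    intro i j k l
    have e : ∀ i l n, (g • Γ) i n l = ∑ s, (g⁻¹ : GLTwo) s n * ∑ a, ∑ m, (g⁻¹ : GLTwo) a i * g l m * Γ a s m := by
      intro i l n
      simp only [Christoffel.smul_apply, Fin.sum_univ_two]; ring
    have e' : ∀ n, (g • Γ) j k n = ∑ s, g n s * ∑ b, ∑ m, (g⁻¹ : GLTwo) b j * (g⁻¹ : GLTwo) m k * Γ b m s := by
      intro n
      simp only [Christoffel.smul_apply, Fin.sum_univ_two]; ring
    simp only [e i l, e']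
    have : ∀ u v : Fin 2 → ℝ, ∑ n, (∑ s, (g⁻¹ : GLTwo) s n * u s) * (∑ s, g n s * v s) = ∑ s, u s * v s := by
      intro u v
      simp only [Fin.sum_univ_two]
      linear_combination (u 0 * v 0) * h0 + (u 0 * v 1) * h1 + (u 1 * v 0) * h2 + (u 1 * v 1) * h3
    rw [this]
    simp only [Fin.sum_univ_two]; ring
  simp only [curvature, partialDeriv_const, key]
  simp only [Fin.sum_univ_two]; ring

theorem symRicci_const_smul (g : GLTwo) (Γ : Christoffel) (y : Plane) :
    symRicci (fun _ => g • Γ) y = ((g⁻¹ : GLTwo) : Matrix (Fin 2) (Fin 2) ℝ).transpose *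
      symRicci (fun _ => Γ) y * ((g⁻¹ : GLTwo) : Matrix (Fin 2) (Fin 2) ℝ) := by
  have h : ((g⁻¹ : GLTwo) : Matrix (Fin 2) (Fin 2) ℝ) * (g : Matrix (Fin 2) (Fin 2) ℝ) = 1 := by
    rw [← Units.val_mul, inv_mul_cancel, Units.val_one]
  have h0 := congrFun (congrFun h 0) 0
  have h1 := congrFun (congrFun h 0) 1
  have h2 := congrFun (congrFun h 1) 0
  have h3 := congrFun (congrFun h 1) 1
  simp only [Matrix.mul_apply, Fin.sum_univ_two, Matrix.one_apply_eq, Matrix.one_apply_ne, ne_eq,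
    zero_ne_one, one_ne_zero, not_false_eq_true] at h0 h1 h2 h3
  have key : ∀ j k, ricci (fun _ => g • Γ) y j k =
      ∑ b, ∑ n, (g⁻¹ : GLTwo) b j * (g⁻¹ : GLTwo) n k * ricci (fun _ => Γ) y b n := by
    intro j k
    simp only [ricci, Matrix.of_apply, curvature_const_smul]
    generalize curvature (fun _ => Γ) y = R
    have : ∀ w : Fin 2 → Fin 2 → ℝ,
        ∑ i, ∑ a, ∑ m, (g⁻¹ : GLTwo) a i * g i m * w a m = ∑ a, w a a := by
      intro w
      simp only [Fin.sum_univ_two]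
      linear_combination w 0 0 * h0 + w 0 1 * h1 + w 1 0 * h2 + w 1 1 * h3
    have := this fun a m => ∑ b, ∑ n, (g⁻¹ : GLTwo) b j * (g⁻¹ : GLTwo) n k * R a b n m
    simp only [Fin.sum_univ_two] at this ⊢
    linear_combination this
  ext j k
  simp only [symRicci, Matrix.smul_apply, Matrix.add_apply, Matrix.transpose_apply, key,
    Matrix.mul_apply, Fin.sum_univ_two, smul_eq_mul]
  ring

theorem HasSignature.congr {B : Matrix (Fin 2) (Fin 2) ℝ} {p q : ℕ} (hB : HasSignature B p q)
    (g : GLTwo) : HasSignature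
      ((g : Matrix (Fin 2) (Fin 2) ℝ).transpose * B * (g : Matrix (Fin 2) (Fin 2) ℝ)) p q := by
  obtain ⟨h1, h2, h3⟩ := hB
  have hg : (g : Matrix (Fin 2) (Fin 2) ℝ).det ≠ 0 := Matrix.GeneralLinearGroup.det_ne_zero g
  have e : QuadraticMap.Equivalent
      ((g : Matrix (Fin 2) (Fin 2) ℝ).transpose * B *
        (g : Matrix (Fin 2) (Fin 2) ℝ)).toQuadraticForm' B.toQuadraticForm' := by
    refine ⟨⟨Matrix.toLinearEquiv' _ (Matrix.invertibleOfIsUnitDet _ (isUnit_iff_ne_zero.mpr hg)), fun v => ?_⟩⟩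
    simp [Matrix.toQuadraticForm', Matrix.toLinearMap₂'_apply', Matrix.toLinearEquiv', Matrix.mul_apply,
      Matrix.mulVec, dotProduct, Fin.sum_univ_two]
    ring
  refine ⟨?_, e.sigNeg_eq.trans h2, e.sigPos_eq.trans h3⟩
  rw [Matrix.det_mul, Matrix.det_mul, Matrix.det_transpose]
  exact mul_ne_zero (mul_ne_zero hg h1) hg

theorem Christoffel.smul_mem_W {p q : ℕ} {Γ : Christoffel} (hΓ : Γ ∈ Christoffel.W p q) (g : GLTwo) : g • Γ ∈ Christoffel.W p q := by
  change HasSignature _ p q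
  rw [symRicci_const_smul]
  exact HasSignature.congr hΓ g⁻¹

theorem Christoffel.smul_mem_Z {p q : ℕ} {Γ : Christoffel} (hΓ : Γ ∈ Christoffel.Z p q) (g : GLTwo) : g • Γ ∈ Christoffel.Z p q := by
  refine ⟨Christoffel.smul_mem_W hΓ.1 g, fun i j k => ?_⟩
  simp only [Christoffel.smul_apply, Fin.sum_univ_two, hΓ.2 1 0]
  ring

noncomputable instance Christoffel.W.instMulAction (p q : ℕ) : MulAction GLTwo (Christoffel.W p q) where
  smul g Γ := ⟨g • Γ.1, Christoffel.smul_mem_W Γ.2 g⟩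
  one_smul Γ := Subtype.ext (one_smul GLTwo Γ.1)
  mul_smul g h Γ := Subtype.ext (mul_smul g h Γ.1)

noncomputable instance Christoffel.Z.instMulAction (p q : ℕ) : MulAction GLTwo (Christoffel.Z p q) where
  smul g Γ := ⟨g • Γ.1, Christoffel.smul_mem_Z Γ.2 g⟩
  one_smul Γ := Subtype.ext (one_smul GLTwo Γ.1)
  mul_smul g h Γ := Subtype.ext (mul_smul g h Γ.1)

/-! ### Surfaces with a connection -/

/-- A smooth connected surface `M` with a smooth connection `∇` on its tangent bundle; `∇` may have
torsion. In Mathlib's notation `conn Y x v` is `∇_v Y` at the point `x`. -/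
structure AffineSurface where
  carrier : Type
  [topology : TopologicalSpace carrier]
  [charted : ChartedSpace Plane carrier]
  [manifold : IsManifold (𝓡 2) ∞ carrier]
  [hausdorff : T2Space carrier]
  [secondCountable : SecondCountableTopology carrier]
  [connected : ConnectedSpace carrier]
  conn : CovariantDerivative (𝓡 2) Plane (TangentSpace (𝓡 2) : carrier → Type)
  [smooth : CovariantDerivative.ContMDiffCovariantDerivative conn ∞]

attribute [instance] AffineSurface.topology AffineSurface.charted AffineSurface.manifold
  AffineSurface.hausdorff AffineSurface.secondCountable AffineSurface.connected
  AffineSurface.smooth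

namespace AffineSurface

/-- The smooth coordinate charts of `M`. -/
def charts (S : AffineSurface) : Set (OpenPartialHomeomorph S.carrier Plane) :=
  IsManifold.maximalAtlas (𝓡 2) ∞ S.carrier

/-- The coordinate vector field `∂_i` of the chart `e`, meaningful on the domain of `e`. -/
noncomputable def coordField (S : AffineSurface) (e : OpenPartialHomeomorph S.carrier Plane)
    (i : Fin 2) : Π x : S.carrier, TangentSpace (𝓡 2) x :=
  VectorField.mpullback (𝓡 2) 𝓘(ℝ, Plane) e (fun _ => EuclideanSpace.single i (1 : ℝ))

/-- The Christoffel symbols of `∇` in the chart `e` at the point `x` of its domain: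
`Γ_{ij}{}^k = dx^k (∇_{∂_i} ∂_j)`. -/
noncomputable def christoffel (S : AffineSurface) (e : OpenPartialHomeomorph S.carrier Plane)
    (x : S.carrier) : Christoffel := fun i j k =>
  EuclideanSpace.proj k (mfderiv (𝓡 2) 𝓘(ℝ, Plane) e x
    (S.conn (S.coordField e j) x (S.coordField e i x)))

/-- In the chart `e` the Christoffel symbols are constant, equal to `Γ`. -/
def IsTypeAChart (S : AffineSurface) (e : OpenPartialHomeomorph S.carrier Plane)
    (Γ : Christoffel) : Prop :=
  e ∈ S.charts ∧ ∀ x ∈ e.source, S.christoffel e x = Γ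

/-- `M` is of Type `𝒜`: it is covered by charts with constant Christoffel symbols. -/
def IsTypeA (S : AffineSurface) : Prop :=
  ∀ P : S.carrier, ∃ e Γ, P ∈ e.source ∧ S.IsTypeAChart e Γ

/-- At every point, and in every chart around it, the symmetric Ricci tensor is non-degenerate of
signature `(p, q)`. -/
def HasRicciSignature (S : AffineSurface) (p q : ℕ) : Prop :=
  ∀ e ∈ S.charts, ∀ x ∈ e.source,
    HasSignature (symRicci (fun y => S.christoffel e (e.symm y)) (e x)) p q

/-- `∇` is torsion free. -/
def IsTorsionFree (S : AffineSurface) : Prop :=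
  S.conn.torsion = 0

/-- `φ` is a diffeomorphism from an open subset of `S` to an open subset of `T` that carries the
connection of `S` to that of `T`: `φ_* (∇_v (φ^* Y)) = ∇_{φ_* v} Y` for every vector field `Y` on `T`
that is differentiable at the point in question and every tangent vector `v`. -/
def IsAffineDiffeo (S T : AffineSurface) (φ : OpenPartialHomeomorph S.carrier T.carrier) : Prop :=
  ContMDiffOn (𝓡 2) (𝓡 2) ∞ φ φ.source ∧ ContMDiffOn (𝓡 2) (𝓡 2) ∞ φ.symm φ.target ∧
  ∀ x ∈ φ.source, ∀ Y : Π y : T.carrier, TangentSpace (𝓡 2) y,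
    MDifferentiableAt (𝓡 2) ((𝓡 2).prod 𝓘(ℝ, Plane))
      (fun y => (⟨y, Y y⟩ : TangentBundle (𝓡 2) T.carrier)) (φ x) →
    ∀ v : TangentSpace (𝓡 2) x,
      mfderiv (𝓡 2) (𝓡 2) φ x (S.conn (VectorField.mpullback (𝓡 2) (𝓡 2) φ Y) x v) =
        T.conn Y (φ x) (mfderiv (𝓡 2) (𝓡 2) φ x v)

/-- `S` and `T` have the same local geometry: for any points `P` of `S` and `Q` of `T` there is the
germ of a local diffeomorphism taking `P` to `Q` and the one connection to the other. -/
def LocallyIsomorphic (S T : AffineSurface) : Prop :=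
  ∀ (P : S.carrier) (Q : T.carrier), ∃ φ : OpenPartialHomeomorph S.carrier T.carrier,
    P ∈ φ.source ∧ φ P = Q ∧ IsAffineDiffeo S T φ

end AffineSurface

/-- A connected surface with a connection and an orientation; the orientation is given by an atlas
of smooth charts whose transition functions have positive Jacobian determinant. -/
structure OrientedAffineSurface extends AffineSurface where
  orientedAtlas : Set (OpenPartialHomeomorph carrier Plane)
  orientedAtlas_subset : orientedAtlas ⊆ toAffineSurface.charts
  orientedAtlas_cover : ∀ x, ∃ e ∈ orientedAtlas, x ∈ e.source
  orientedAtlas_compat : ∀ e ∈ orientedAtlas, ∀ e' ∈ orientedAtlas,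
    ∀ x ∈ e.source ∩ e'.source, 0 < (fderiv ℝ (e' ∘ e.symm) (e x)).det

namespace OrientedAffineSurface

/-- The chart `e` is positively oriented. -/
def IsPositiveChart (S : OrientedAffineSurface) (e : OpenPartialHomeomorph S.carrier Plane) : Prop :=
  ∀ e' ∈ S.orientedAtlas, ∀ x ∈ e.source ∩ e'.source, 0 < (fderiv ℝ (e' ∘ e.symm) (e x)).det

/-- The local diffeomorphism `φ` preserves the orientation. -/
def PreservesOrientation (S T : OrientedAffineSurface)
    (φ : OpenPartialHomeomorph S.carrier T.carrier) : Prop :=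
  ∀ e ∈ S.orientedAtlas, ∀ e' ∈ T.orientedAtlas, ∀ x ∈ φ.source, x ∈ e.source → φ x ∈ e'.source →
    0 < (fderiv ℝ (e' ∘ φ ∘ e.symm) (e x)).det

/-- `S` and `T` have the same oriented local geometry: for any points `P` of `S` and `Q` of `T` there
is the germ of an orientation preserving local diffeomorphism taking `P` to `Q` and the one
connection to the other. -/
def LocallyIsomorphic (S T : OrientedAffineSurface) : Prop :=
  ∀ (P : S.carrier) (Q : T.carrier), ∃ φ : OpenPartialHomeomorph S.carrier T.carrier,
    P ∈ φ.source ∧ φ P = Q ∧ AffineSurface.IsAffineDiffeo S.toAffineSurface T.toAffineSurface φ ∧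
      PreservesOrientation S T φ

end OrientedAffineSurface

/-! ### Moduli spaces -/

/-- Type `𝒜` surfaces, possibly with torsion, with `ρ_s` non-degenerate of signature `(p, q)`. -/
def StructW (p q : ℕ) : Type 1 :=
  {S : AffineSurface // S.IsTypeA ∧ S.HasRicciSignature p q}

/-- Torsion-free Type `𝒜` surfaces with `ρ_s` non-degenerate of signature `(p, q)`. -/
def StructZ (p q : ℕ) : Type 1 :=
  {S : AffineSurface // S.IsTypeA ∧ S.HasRicciSignature p q ∧ S.IsTorsionFree}

/-- Oriented Type `𝒜` surfaces, possibly with torsion, with `ρ_s` non-degenerate of signature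
`(p, q)`. -/
def StructWPlus (p q : ℕ) : Type 1 :=
  {S : OrientedAffineSurface // S.IsTypeA ∧ S.HasRicciSignature p q}

/-- Oriented torsion-free Type `𝒜` surfaces with `ρ_s` non-degenerate of signature `(p, q)`. -/
def StructZPlus (p q : ℕ) : Type 1 :=
  {S : OrientedAffineSurface // S.IsTypeA ∧ S.HasRicciSignature p q ∧ S.IsTorsionFree}

/-- Local isomorphism of unoriented structures. -/
def StructW.rel {p q : ℕ} (S T : StructW p q) : Prop := S.1.LocallyIsomorphic T.1

/-- Local isomorphism of unoriented structures. -/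
def StructZ.rel {p q : ℕ} (S T : StructZ p q) : Prop := S.1.LocallyIsomorphic T.1

/-- Oriented local isomorphism. -/
def StructWPlus.rel {p q : ℕ} (S T : StructWPlus p q) : Prop := S.1.LocallyIsomorphic T.1

/-- Oriented local isomorphism. -/
def StructZPlus.rel {p q : ℕ} (S T : StructZPlus p q) : Prop := S.1.LocallyIsomorphic T.1

/-- `𝔚(p, q)`: unoriented Type `𝒜` structures up to local isomorphism. -/
def ModuliW (p q : ℕ) : Type 1 := Quot (StructW.rel (p := p) (q := q))

/-- `ℨ(p, q)`: unoriented torsion-free Type `𝒜` structures up to local isomorphism. -/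
def ModuliZ (p q : ℕ) : Type 1 := Quot (StructZ.rel (p := p) (q := q))

/-- `𝔚⁺(p, q)`: oriented Type `𝒜` structures up to oriented local isomorphism. -/
def ModuliWPlus (p q : ℕ) : Type 1 := Quot (StructWPlus.rel (p := p) (q := q))

/-- `ℨ⁺(p, q)`: oriented torsion-free Type `𝒜` structures up to oriented local isomorphism. -/
def ModuliZPlus (p q : ℕ) : Type 1 := Quot (StructZPlus.rel (p := p) (q := q))

/-! Everything rests on a rigidity statement. Let `ψ` be a diffeomorphism between open sets of the
plane that carries constant symbols `Γ` to constant symbols `Γ'`. Curvature is tensorial, so `Dψ`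
pulls the symmetric Ricci form of `Γ'` back to that of `Γ`. Both forms are constant and the first is
non-degenerate, so `ψ` is an isometry of flat metrics and `D²ψ = 0`. The inhomogeneous term of the
transformation law of Christoffel symbols then vanishes, and the law says exactly that `Γ' = g • Γ`
with `g = Dψ`. This is `curvatureOp_transforms`, `fderiv_fderiv_eq_zero_of_transforms` and
`Christoffel.eq_smul_of_transforms`.

On a surface, `tangentCoord_conn` writes the connection in a chart, and
`IsAffineDiffeo.transformsAt` turns an affine diffeomorphism into the transformation law. Applied to
the identity, rigidity puts the symbols of two overlapping Type 𝒜 charts in one orbit; by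
connectedness (`setoid_of_overlap`) the orbit depends on the surface alone. Applied to a local
isomorphism, it shows that the orbit is an invariant of the class. Conversely, if `Γ' = g • Γ`, the
map that is affine with linear part `g` in the two charts is a local isomorphism (`affineGlue`), and
it may take any point of one domain to any point of the other. Every orbit occurs, on the plane with
constant symbols. `exists_equiv_of_invariant` converts such a complete invariant into the bijection.

In the oriented cases the same argument runs with positive charts only, which exist at each point
after a reflection of the coordinates if necessary; the matrix `g` is a Jacobian between positive
charts, so its determinant is positive. -/

open scoped Topology

/-! ### Symbols, forms and matrices as linear-algebraic objects on the plane -/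

/-- The bilinear map `(u, v) ↦ ∑ k, Γ_{ij}{}^k u^i v^j ∂_k`. -/
noncomputable def Christoffel.toBilin (Γ : Christoffel) : Plane →L[ℝ] Plane →L[ℝ] Plane :=
  ∑ i, ∑ j, ∑ k, Γ i j k • (EuclideanSpace.proj (𝕜 := ℝ) i).smulRight
    ((EuclideanSpace.proj (𝕜 := ℝ) j).smulRight (EuclideanSpace.single k (1 : ℝ)))

theorem Christoffel.toBilin_apply (Γ : Christoffel) (u v : Plane) (k : Fin 2) :
    Γ.toBilin u v k = ∑ i, ∑ j, u i * v j * Γ i j k := by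
  fin_cases k <;> simp [Christoffel.toBilin] <;> ring

theorem Christoffel.toBilin_single (Γ : Christoffel) (i j k : Fin 2) :
    Γ.toBilin (EuclideanSpace.single i 1) (EuclideanSpace.single j 1) k = Γ i j k := by
  rw [Christoffel.toBilin_apply]
  fin_cases i <;> fin_cases j <;> simp

theorem Christoffel.toBilin_injective : Function.Injective Christoffel.toBilin := by
  intro Γ Γ' h
  funext i j k
  rw [← Christoffel.toBilin_single Γ, h, Christoffel.toBilin_single]

/-- The bilinear form with the given matrix. -/
noncomputable def bilinOfMatrix (M : Matrix (Fin 2) (Fin 2) ℝ) : Plane →L[ℝ] Plane →L[ℝ] ℝ :=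
  ∑ i, ∑ j, M i j • (EuclideanSpace.proj (𝕜 := ℝ) i).smulRight (EuclideanSpace.proj (𝕜 := ℝ) j)

theorem bilinOfMatrix_apply (M : Matrix (Fin 2) (Fin 2) ℝ) (u v : Plane) :
    bilinOfMatrix M u v = ∑ i, ∑ j, u i * v j * M i j := by
  simp [bilinOfMatrix]; ring

theorem bilinOfMatrix_single (M : Matrix (Fin 2) (Fin 2) ℝ) (i j : Fin 2) :
    bilinOfMatrix M (EuclideanSpace.single i 1) (EuclideanSpace.single j 1) = M i j := by
  rw [bilinOfMatrix_apply]
  fin_cases i <;> fin_cases j <;> simp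

theorem Plane.eq_sum (u : Plane) :
    u = u 0 • EuclideanSpace.single 0 (1 : ℝ) + u 1 • EuclideanSpace.single 1 (1 : ℝ) := by
  ext k; fin_cases k <;> simp

theorem bilinOfMatrix_nondegenerate {M : Matrix (Fin 2) (Fin 2) ℝ} (hM : M.det ≠ 0) {u : Plane}
    (h : ∀ v, bilinOfMatrix M u v = 0) : u = 0 := by
  have h0 := h (EuclideanSpace.single 0 1)
  have h1 := h (EuclideanSpace.single 1 1)
  simp [bilinOfMatrix_apply] at h0 h1
  rw [Matrix.det_fin_two] at hM
  ext k
  fin_cases k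
  · have : u 0 * (M 0 0 * M 1 1 - M 0 1 * M 1 0) = 0 := by linear_combination M 1 1 * h0 - M 1 0 * h1
    simpa [hM] using this
  · have : u 1 * (M 0 0 * M 1 1 - M 0 1 * M 1 0) = 0 := by linear_combination M 0 0 * h1 - M 0 1 * h0
    simpa [hM] using this

/-- The linear map of the plane with matrix `g`. -/
noncomputable def GLTwo.toCLM (g : GLTwo) : Plane →L[ℝ] Plane :=
  Matrix.toEuclideanCLM (n := Fin 2) (𝕜 := ℝ) (g : Matrix (Fin 2) (Fin 2) ℝ)

theorem GLTwo.toCLM_apply (g : GLTwo) (u : Plane) (k : Fin 2) : g.toCLM u k = ∑ i, g k i * u i := by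
  simp [GLTwo.toCLM, Matrix.mulVec, dotProduct]

theorem GLTwo.toCLM_mul (g h : GLTwo) : (g * h).toCLM = g.toCLM ∘L h.toCLM := by
  simp only [GLTwo.toCLM, Units.val_mul, map_mul]; rfl

theorem GLTwo.toCLM_one : (1 : GLTwo).toCLM = ContinuousLinearMap.id ℝ Plane := by
  simp only [GLTwo.toCLM, Units.val_one, map_one]; rfl

theorem GLTwo.toCLM_inv_apply (g : GLTwo) (u : Plane) : g.toCLM ((g⁻¹ : GLTwo).toCLM u) = u := by
  rw [← ContinuousLinearMap.comp_apply, ← GLTwo.toCLM_mul, mul_inv_cancel, GLTwo.toCLM_one]; rfl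

theorem GLTwo.inv_toCLM_apply (g : GLTwo) (u : Plane) : (g⁻¹ : GLTwo).toCLM (g.toCLM u) = u := by
  rw [← ContinuousLinearMap.comp_apply, ← GLTwo.toCLM_mul, inv_mul_cancel, GLTwo.toCLM_one]; rfl

theorem toEuclideanCLM_det (M : Matrix (Fin 2) (Fin 2) ℝ) :
    (Matrix.toEuclideanCLM (n := Fin 2) (𝕜 := ℝ) M).det = M.det := by
  rw [ContinuousLinearMap.det, Matrix.coe_toEuclideanCLM_eq_toEuclideanLin]
  exact (congrArg LinearMap.det (congrFun (congrArg _ (Matrix.toLpLin_eq_toLin 2 2)) M)).trans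
    (LinearMap.det_toLin _ M)

theorem GLTwo.toCLM_det (g : GLTwo) : g.toCLM.det = (g : Matrix (Fin 2) (Fin 2) ℝ).det :=
  toEuclideanCLM_det _

theorem exists_toCLM_eq {J : Plane →L[ℝ] Plane} (hJ : J.IsInvertible) : ∃ g : GLTwo, g.toCLM = J := by
  have h := (Matrix.toEuclideanCLM (n := Fin 2) (𝕜 := ℝ)).apply_symm_apply J
  have hd : ((Matrix.toEuclideanCLM (n := Fin 2) (𝕜 := ℝ)).symm J).det ≠ 0 := by
    rw [← toEuclideanCLM_det, h]
    obtain ⟨E, rfl⟩ := hJ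
    exact (LinearEquiv.isUnit_det' E.toLinearEquiv).ne_zero
  exact ⟨Matrix.GeneralLinearGroup.mkOfDetNeZero _ hd, h⟩

/-- Viewing `Γ` as a product on the plane, the action is transport of structure: `g` becomes an
algebra isomorphism, and no inverse matrix is needed to say so. The converse below is how orbit
membership is always verified. -/
theorem Christoffel.toBilin_smul (g : GLTwo) (Γ : Christoffel) (u v : Plane) :
    (g • Γ).toBilin (g.toCLM u) (g.toCLM v) = g.toCLM (Γ.toBilin u v) := by
  have key : ∀ u v, (g • Γ).toBilin u v =
      g.toCLM (Γ.toBilin ((g⁻¹ : GLTwo).toCLM u) ((g⁻¹ : GLTwo).toCLM v)) := by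
    intro u v
    ext k
    simp only [Christoffel.toBilin_apply, GLTwo.toCLM_apply, Christoffel.smul_apply,
      Fin.sum_univ_two]
    ring
  rw [key, GLTwo.inv_toCLM_apply, GLTwo.inv_toCLM_apply]

theorem Christoffel.eq_smul_of_toBilin {g : GLTwo} {Γ Γ' : Christoffel}
    (h : ∀ u v, Γ'.toBilin (g.toCLM u) (g.toCLM v) = g.toCLM (Γ.toBilin u v)) : Γ' = g • Γ := by
  apply Christoffel.toBilin_injective
  ext u v : 2
  rw [← GLTwo.toCLM_inv_apply g u, ← GLTwo.toCLM_inv_apply g v, h, Christoffel.toBilin_smul]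

/-! ### Curvature and Ricci tensor of variable symbols -/

/-- The symbols `G` depend differentiably on the point `x`. -/
def Christoffel.DiffAt (G : Plane → Christoffel) (x : Plane) : Prop :=
  ∀ i j k, DifferentiableAt ℝ (fun y => G y i j k) x

theorem Christoffel.DiffAt.hasFDerivAt_toBilin {G : Plane → Christoffel} {x : Plane}
    (h : Christoffel.DiffAt G x) (u v : Plane) :
    HasFDerivAt (fun y => (G y).toBilin u v)
      (∑ i, ∑ j, ∑ k, (fderiv ℝ (fun y => G y i j k) x).smulRight
        ((u i * v j) • EuclideanSpace.single k (1 : ℝ))) x := by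
  have : (fun y => (G y).toBilin u v) =
      fun y => ∑ i, ∑ j, ∑ k, G y i j k • ((u i * v j) • EuclideanSpace.single k (1 : ℝ)) := by
    funext y
    simp [Christoffel.toBilin, Fin.sum_univ_two, smul_smul, mul_assoc]
  rw [this]
  refine HasFDerivAt.fun_sum fun i _ => HasFDerivAt.fun_sum fun j _ => HasFDerivAt.fun_sum fun k _ => ?_
  exact (h i j k).hasFDerivAt.smul_const _

theorem two_le_infty : (2 : ℕ∞ω) ≤ ∞ := by
  exact WithTop.coe_le_coe.2 (le_top : (2 : ℕ∞) ≤ ⊤)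

theorem minSmoothness_two_le_infty : minSmoothness ℝ 2 ≤ ∞ := by simpa using two_le_infty

/-- The curvature operator `R(w, u) v` of the connection with symbols `G`. -/
noncomputable def curvatureOp (G : Plane → Christoffel) (x w u v : Plane) : Plane :=
  fderiv ℝ (fun y => (G y).toBilin u v) x w - fderiv ℝ (fun y => (G y).toBilin w v) x u
    + (G x).toBilin w ((G x).toBilin u v) - (G x).toBilin u ((G x).toBilin w v)

theorem curvatureOp_apply {G : Plane → Christoffel} {x : Plane} (h : Christoffel.DiffAt G x)
    (w u v : Plane) (l : Fin 2) : curvatureOp G x w u v l =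
      ∑ i, ∑ j, ∑ k, w i * u j * v k * curvature G x i j k l := by
  have e : ∀ (i : Fin 2) (f : Plane → ℝ), fderiv ℝ f x (EuclideanSpace.single i 1) = partialDeriv i f x :=
    fun _ _ => rfl
  have e' : ∀ (f : Plane → ℝ) (w : Plane), fderiv ℝ f x w =
      w 0 * partialDeriv 0 f x + w 1 * partialDeriv 1 f x := by
    intro f w
    conv_lhs => rw [Plane.eq_sum w]
    simp only [map_add, map_smul, smul_eq_mul, e]
  simp only [curvatureOp, (h.hasFDerivAt_toBilin _ _).fderiv, curvature]
  fin_cases l <;>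
  · simp [e', Fin.sum_univ_two, Christoffel.toBilin_apply]
    ring

theorem curvatureOp_add_left {G : Plane → Christoffel} {x : Plane} (h : Christoffel.DiffAt G x)
    (w w' u v : Plane) :
    curvatureOp G x (w + w') u v = curvatureOp G x w u v + curvatureOp G x w' u v := by
  ext l
  simp only [PiLp.add_apply, curvatureOp_apply h, Fin.sum_univ_two]; ring

theorem curvatureOp_smul_left {G : Plane → Christoffel} {x : Plane} (h : Christoffel.DiffAt G x)
    (c : ℝ) (w u v : Plane) : curvatureOp G x (c • w) u v = c • curvatureOp G x w u v := by
  ext l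
  simp only [PiLp.smul_apply, smul_eq_mul, curvatureOp_apply h, Fin.sum_univ_two]; ring

/-- The trace form of the Ricci tensor reduces its invariance to that of the curvature operator,
since a trace is unchanged by conjugation. -/
theorem bilinOfMatrix_ricci {G : Plane → Christoffel} {x : Plane} (h : Christoffel.DiffAt G x)
    (u v : Plane) : bilinOfMatrix (ricci G x) u v =
      LinearMap.trace ℝ Plane
        { toFun := fun w => curvatureOp G x w u v
          map_add' := fun w w' => curvatureOp_add_left h w w' u v
          map_smul' := fun c w => curvatureOp_smul_left h c w u v } := by
  rw [LinearMap.trace_eq_sum_inner _ (EuclideanSpace.basisFun (Fin 2) ℝ), bilinOfMatrix_apply]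
  simp [ricci, Fin.sum_univ_two, EuclideanSpace.inner_single_left, curvatureOp_apply h]
  ring

theorem bilinOfMatrix_symRicci (G : Plane → Christoffel) (x u v : Plane) :
    bilinOfMatrix (symRicci G x) u v =
      (1 / 2) * (bilinOfMatrix (ricci G x) u v + bilinOfMatrix (ricci G x) v u) := by
  simp [bilinOfMatrix_apply, symRicci, Fin.sum_univ_two]; ring

theorem bilinOfMatrix_symRicci_comm (G : Plane → Christoffel) (x u v : Plane) :
    bilinOfMatrix (symRicci G x) u v = bilinOfMatrix (symRicci G x) v u := by
  rw [bilinOfMatrix_symRicci, bilinOfMatrix_symRicci, add_comm]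

theorem Christoffel.diffAt_const (Γ : Christoffel) (x : Plane) : Christoffel.DiffAt (fun _ => Γ) x :=
  fun _ _ _ => differentiableAt_const _

theorem symRicci_const (Γ : Christoffel) (x y : Plane) :
    symRicci (fun _ => Γ) x = symRicci (fun _ => Γ) y := by
  ext j k
  simp [symRicci, ricci, curvature, partialDeriv_const]

theorem symRicci_congr {G G' : Plane → Christoffel} {x : Plane} (h : G =ᶠ[𝓝 x] G') :
    symRicci G x = symRicci G' x := by
  have h0 := h.self_of_nhds
  have : ∀ a i j k, partialDeriv a (fun y => G y i j k) x = partialDeriv a (fun y => G' y i j k) x := by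
    intro a i j k
    unfold partialDeriv
    rw [Filter.EventuallyEq.fderiv_eq]
    filter_upwards [h] with y hy
    rw [hy]
  ext j k
  simp [symRicci, ricci, curvature, this, h0]

theorem bilinOfMatrix_ricci_congr_equiv {G G' : Plane → Christoffel} {x x' : Plane}
    (h : Christoffel.DiffAt G x) (h' : Christoffel.DiffAt G' x') (J : Plane ≃L[ℝ] Plane)
    (hR : ∀ w u v, J (curvatureOp G x w u v) = curvatureOp G' x' (J w) (J u) (J v)) (u v : Plane) :
    bilinOfMatrix (ricci G x) u v = bilinOfMatrix (ricci G' x') (J u) (J v) := by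
  rw [bilinOfMatrix_ricci h, bilinOfMatrix_ricci h', ← LinearMap.trace_conj' _ J.toLinearEquiv]
  congr 1
  ext w : 1
  simp only [LinearEquiv.conj_apply_apply, LinearMap.coe_mk, AddHom.coe_mk,
    ContinuousLinearEquiv.coe_toLinearEquiv, ContinuousLinearEquiv.coe_symm_toLinearEquiv]
  rw [hR, ContinuousLinearEquiv.apply_symm_apply]

/-! ### The transformation law and rigidity -/

/-- The transformation law of Christoffel symbols under `ψ`, at the point `y`. -/
def TransformsAt (ψ : Plane → Plane) (G : Plane → Christoffel) (Γ' : Christoffel) (y : Plane) : Prop :=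
  ∀ u v, fderiv ℝ (fderiv ℝ ψ) y u v + Γ'.toBilin (fderiv ℝ ψ y u) (fderiv ℝ ψ y v) =
    fderiv ℝ ψ y ((G y).toBilin u v)

/-- The transformation law holds near `x`, so it can be differentiated. Antisymmetrising the result
in the two directions removes the third derivatives of `ψ`, and the law itself eliminates the second
derivatives that remain. The point `x'` is arbitrary because the symbols `Γ'` are constant. -/
theorem curvatureOp_transforms {ψ : Plane → Plane} {G : Plane → Christoffel} {Γ' : Christoffel}
    {x : Plane} (hψ : ContDiffAt ℝ ∞ ψ x) (hG : Christoffel.DiffAt G x)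
    (h : ∀ᶠ y in 𝓝 x, TransformsAt ψ G Γ' y) (x' w u v : Plane) :
    fderiv ℝ ψ x (curvatureOp G x w u v) =
      curvatureOp (fun _ => Γ') x' (fderiv ℝ ψ x w) (fderiv ℝ ψ x u) (fderiv ℝ ψ x v) := by
  have hJ : ContDiffAt ℝ ∞ (fderiv ℝ ψ) x := hψ.fderiv_right (by simp)
  have hJJ : ContDiffAt ℝ ∞ (fderiv ℝ (fderiv ℝ ψ)) x := hJ.fderiv_right (by simp)
  have dJ := (hJ.differentiableAt (by simp)).hasFDerivAt
  have dJJ := (hJJ.differentiableAt (by simp)).hasFDerivAt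
  have s2 := hψ.isSymmSndFDerivAt minSmoothness_two_le_infty
  have s3 := hJ.isSymmSndFDerivAt minSmoothness_two_le_infty
  have hx := h.self_of_nhds
  -- The law for `u`, `v`, differentiated in the direction `w`.
  have D : ∀ w u v, fderiv ℝ (fderiv ℝ (fderiv ℝ ψ)) x w u v
      + (Γ'.toBilin (fderiv ℝ (fderiv ℝ ψ) x w u) (fderiv ℝ ψ x v)
        + Γ'.toBilin (fderiv ℝ ψ x u) (fderiv ℝ (fderiv ℝ ψ) x w v)) =
      fderiv ℝ (fderiv ℝ ψ) x w ((G x).toBilin u v)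
        + fderiv ℝ ψ x (fderiv ℝ (fun y => (G y).toBilin u v) x w) := by
    intro w u v
    have hg := (hG.hasFDerivAt_toBilin u v).differentiableAt.hasFDerivAt
    have e1 : HasFDerivAt (fun y => fderiv ℝ (fderiv ℝ ψ) y u v + Γ'.toBilin (fderiv ℝ ψ y u) (fderiv ℝ ψ y v)) _ x :=
      ((dJJ.clm_apply (hasFDerivAt_const u x)).clm_apply (hasFDerivAt_const v x)).add
        ((Γ'.toBilin.hasFDerivAt.comp x (dJ.clm_apply (hasFDerivAt_const u x))).clm_apply
          (dJ.clm_apply (hasFDerivAt_const v x)))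
    have e2 := dJ.clm_apply hg
    have e3 := (e1.congr_of_eventuallyEq (f₁ := fun y => fderiv ℝ ψ y ((G y).toBilin u v)) (by
      filter_upwards [h] with y hy
      exact (hy u v).symm)).unique e2
    have := congrArg (fun T => T w) e3
    simp at this
    rw [add_comm (fderiv ℝ (fderiv ℝ ψ) x w _), ← this]
    abel
  have D1 := D w u v
  have D2 := D u w v
  rw [s3 w u] at D1
  rw [s2 w u] at D1
  have E : ∀ u v, fderiv ℝ (fderiv ℝ ψ) x u v = fderiv ℝ ψ x ((G x).toBilin u v) -
      Γ'.toBilin (fderiv ℝ ψ x u) (fderiv ℝ ψ x v) := fun u v => eq_sub_of_add_eq (hx u v)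
  simp only [curvatureOp, map_add, map_sub]
  -- `E` is instantiated only where needed: the term with `D²ψ(u, w)` now occurs in both identities
  -- and cancels in their difference.
  simp only [E w, E u v, E u (((G x).toBilin w) v), map_sub] at D1 D2
  have := congrArg₂ (fun a b => b - a) D1 D2
  simp
  rw [← sub_eq_zero] at this ⊢
  rw [← this]
  abel

theorem symRicci_transforms {ψ : Plane → Plane} {G : Plane → Christoffel} {Γ' : Christoffel}
    {x : Plane} (hψ : ContDiffAt ℝ ∞ ψ x) (hG : Christoffel.DiffAt G x)
    (hJ : (fderiv ℝ ψ x).IsInvertible)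
    (h : ∀ᶠ y in 𝓝 x, TransformsAt ψ G Γ' y) (x' u v : Plane) :
    bilinOfMatrix (symRicci G x) u v =
      bilinOfMatrix (symRicci (fun _ => Γ') x') (fderiv ℝ ψ x u) (fderiv ℝ ψ x v) := by
  obtain ⟨J, hJ⟩ := hJ
  have := bilinOfMatrix_ricci_congr_equiv hG (Christoffel.diffAt_const Γ' x') J (by
    intro w u v
    have := curvatureOp_transforms hψ hG h x' w u v
    rwa [← hJ] at this)
  rw [bilinOfMatrix_symRicci, bilinOfMatrix_symRicci, this, this, ← hJ]
  rfl

theorem symRicci_eq_congr {G : Plane → Christoffel} {Γ' : Christoffel} {x x' : Plane} {g : GLTwo}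
    (h : ∀ u v, bilinOfMatrix (symRicci G x) u v =
      bilinOfMatrix (symRicci (fun _ => Γ') x') (g.toCLM u) (g.toCLM v)) :
    symRicci G x = (g : Matrix (Fin 2) (Fin 2) ℝ).transpose * symRicci (fun _ => Γ') x' *
      (g : Matrix (Fin 2) (Fin 2) ℝ) := by
  ext i j
  rw [← bilinOfMatrix_single (symRicci G x) i j, h, bilinOfMatrix_apply]
  simp [Matrix.mul_apply, Fin.sum_univ_two, GLTwo.toCLM_apply]
  fin_cases i <;> fin_cases j <;> simp <;> ring

/-- The form of `G` at `x` is congruent, through the matrix of `Dψ`, to the constant form of `Γ'`.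
Variable symbols are allowed on the source side so that arbitrary charts can be treated. -/
theorem HasSignature.of_transforms {ψ : Plane → Plane} {G : Plane → Christoffel} {Γ' : Christoffel}
    {x : Plane} {p q : ℕ} (hψ : ContDiffAt ℝ ∞ ψ x) (hG : Christoffel.DiffAt G x)
    (hJ : (fderiv ℝ ψ x).IsInvertible) (h : ∀ᶠ y in 𝓝 x, TransformsAt ψ G Γ' y)
    (hΓ' : Γ' ∈ Christoffel.W p q) : HasSignature (symRicci G x) p q := by
  obtain ⟨g, hg⟩ := exists_toCLM_eq hJ
  have := symRicci_transforms hψ hG hJ h 0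
  rw [← hg] at this
  rw [symRicci_eq_congr this]
  exact HasSignature.congr hΓ' g

/-- A map that carries constant Christoffel symbols to constant Christoffel symbols with
non-degenerate symmetric Ricci tensor is affine to second order. -/
theorem fderiv_fderiv_eq_zero_of_transforms {ψ : Plane → Plane} {Γ Γ' : Christoffel} {x : Plane}
    (hψ : ∀ᶠ y in 𝓝 x, ContDiffAt ℝ ∞ ψ y) (hJ : ∀ᶠ y in 𝓝 x, (fderiv ℝ ψ y).IsInvertible)
    (h : ∀ᶠ y in 𝓝 x, TransformsAt ψ (fun _ => Γ) Γ' y)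
    (hd : (symRicci (fun _ => Γ') 0).det ≠ 0) : fderiv ℝ (fderiv ℝ ψ) x = 0 := by
  have hJ' : ContDiffAt ℝ ∞ (fderiv ℝ ψ) x := hψ.self_of_nhds.fderiv_right (by simp)
  have dJ := (hJ'.differentiableAt (by simp)).hasFDerivAt
  have s2 := hψ.self_of_nhds.isSymmSndFDerivAt minSmoothness_two_le_infty
  set β := bilinOfMatrix (symRicci (fun _ => Γ') 0) with hβ
  -- `ψ` is an isometry near `x`: the left side does not depend on `y`.
  have key : ∀ᶠ y in 𝓝 x, ∀ u v, bilinOfMatrix (symRicci (fun _ => Γ) 0) u v =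
      β (fderiv ℝ ψ y u) (fderiv ℝ ψ y v) := by
    filter_upwards [h.eventually_nhds, hJ, hψ] with y hy hJy hψy u v
    rw [← symRicci_transforms hψy (Christoffel.diffAt_const Γ y) hJy hy 0 u v,
      symRicci_const Γ y 0]
  have anti : ∀ w u v, β (fderiv ℝ (fderiv ℝ ψ) x w u) (fderiv ℝ ψ x v) +
      β (fderiv ℝ ψ x u) (fderiv ℝ (fderiv ℝ ψ) x w v) = 0 := by
    intro w u v
    have e1 : HasFDerivAt (fun y => β (fderiv ℝ ψ y u) (fderiv ℝ ψ y v)) _ x :=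
        ((β.hasFDerivAt.comp x (dJ.clm_apply (hasFDerivAt_const u x))).clm_apply
          (dJ.clm_apply (hasFDerivAt_const v x)))
    have e2 := e1.unique ((hasFDerivAt_const (bilinOfMatrix (symRicci (fun _ => Γ) 0) u v) x).congr_of_eventuallyEq (by
      filter_upwards [key] with y hy
      exact (hy u v).symm))
    have := congrArg (fun T => T w) e2
    simp at this
    rw [← this, add_comm]
  -- The argument for uniqueness of the Levi-Civita connection: `T(w, u, v) = β(D²ψ(w, u), Dψ v)` is
  -- symmetric in its first two slots and, by `anti`, antisymmetric in the last two. Three cyclic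
  -- instances give `2 T = 0`.
  have A : ∀ w u v, β (fderiv ℝ (fderiv ℝ ψ) x w u) (fderiv ℝ ψ x v) = 0 := by
    intro w u v
    have c : ∀ a b, β a b = β b a := bilinOfMatrix_symRicci_comm _ _
    have a1 := anti w u v
    have a2 := anti u v w
    have a3 := anti v w u
    rw [c (fderiv ℝ ψ x u)] at a1
    rw [c (fderiv ℝ ψ x v)] at a2
    rw [c (fderiv ℝ ψ x w)] at a3
    rw [s2 w v] at a1
    rw [s2 u w] at a2
    rw [s2 v u] at a3
    linarith
  ext1 w
  ext1 u
  refine bilinOfMatrix_nondegenerate hd fun v => ?_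
  obtain ⟨J, hJx⟩ := hJ.self_of_nhds
  have := A w u (J.symm v)
  rw [← hJx] at this
  simpa using this

theorem Christoffel.eq_smul_of_transforms {ψ : Plane → Plane} {Γ Γ' : Christoffel} {x : Plane}
    (hψ : ∀ᶠ y in 𝓝 x, ContDiffAt ℝ ∞ ψ y) (hJ : ∀ᶠ y in 𝓝 x, (fderiv ℝ ψ y).IsInvertible)
    (h : ∀ᶠ y in 𝓝 x, TransformsAt ψ (fun _ => Γ) Γ' y)
    (hd : (symRicci (fun _ => Γ') 0).det ≠ 0) :
    ∃ g : GLTwo, g.toCLM = fderiv ℝ ψ x ∧ Γ' = g • Γ := by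
  obtain ⟨g, hg⟩ := exists_toCLM_eq hJ.self_of_nhds
  refine ⟨g, hg, Christoffel.eq_smul_of_toBilin fun u v => ?_⟩
  have := h.self_of_nhds u v
  rw [fderiv_fderiv_eq_zero_of_transforms hψ hJ h hd] at this
  simpa [hg] using this

/-! ### Local diffeomorphisms and pullback of vector fields -/

/-- `φ` is a diffeomorphism between open subsets of two surfaces. -/
def SmoothOn {M N : Type*} [TopologicalSpace M] [ChartedSpace Plane M] [TopologicalSpace N]
    [ChartedSpace Plane N] (φ : OpenPartialHomeomorph M N) : Prop :=
  ContMDiffOn (𝓡 2) (𝓡 2) ∞ φ φ.source ∧ ContMDiffOn (𝓡 2) (𝓡 2) ∞ φ.symm φ.target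

namespace SmoothOn

variable {M N K : Type*} [TopologicalSpace M] [ChartedSpace Plane M] [TopologicalSpace N]
    [ChartedSpace Plane N] [TopologicalSpace K] [ChartedSpace Plane K]
    {φ : OpenPartialHomeomorph M N} {χ : OpenPartialHomeomorph N K}

theorem symm (h : SmoothOn φ) : SmoothOn φ.symm := ⟨h.2, h.1⟩

theorem trans (h : SmoothOn φ) (h' : SmoothOn χ) : SmoothOn (φ.trans χ) := by
  constructor
  · rw [OpenPartialHomeomorph.coe_trans]
    exact h'.1.comp (h.1.mono (by intro x hx; simp at hx; exact hx.1))
      (by intro x hx; simp at hx; exact hx.2)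
  · rw [OpenPartialHomeomorph.trans_symm_eq_symm_trans_symm, OpenPartialHomeomorph.coe_trans]
    exact h.2.comp (h'.2.mono (by intro x hx; simp at hx; exact hx.1))
      (by intro x hx; simp at hx; exact hx.2)

theorem refl : SmoothOn (OpenPartialHomeomorph.refl M) := ⟨contMDiffOn_id, contMDiffOn_id⟩

theorem contMDiffAt (h : SmoothOn φ) {x : M} (hx : x ∈ φ.source) :
    ContMDiffAt (𝓡 2) (𝓡 2) ∞ φ x :=
  h.1.contMDiffAt (φ.open_source.mem_nhds hx)

theorem mdifferentiable (h : SmoothOn φ) : φ.MDifferentiable (𝓡 2) (𝓡 2) :=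
  ⟨h.1.mdifferentiableOn (by simp), h.2.mdifferentiableOn (by simp)⟩

theorem isInvertible (h : SmoothOn φ) {x : M} (hx : x ∈ φ.source) :
    (mfderiv (𝓡 2) (𝓡 2) φ x).IsInvertible :=
  ⟨h.mdifferentiable.mfderiv hx, rfl⟩

theorem mfderiv_trans (h : SmoothOn φ) (h' : SmoothOn χ) {x : M} (hx : x ∈ φ.source)
    (hx' : φ x ∈ χ.source) : mfderiv (𝓡 2) (𝓡 2) (φ.trans χ) x =
      (mfderiv (𝓡 2) (𝓡 2) χ (φ x)).comp (mfderiv (𝓡 2) (𝓡 2) φ x) := by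
  rw [OpenPartialHomeomorph.coe_trans]
  exact mfderiv_comp x (h'.mdifferentiable.mdifferentiableAt hx')
    (h.mdifferentiable.mdifferentiableAt hx)

theorem mfderiv_mpullback (h : SmoothOn φ) {x : M} (hx : x ∈ φ.source)
    (Y : Π y : N, TangentSpace (𝓡 2) y) :
    mfderiv (𝓡 2) (𝓡 2) φ x (VectorField.mpullback (𝓡 2) (𝓡 2) φ Y x) = Y (φ x) := by
  rw [VectorField.mpullback_apply, (h.isInvertible hx).self_apply_inverse]

theorem mdifferentiableAt_mpullback [IsManifold (𝓡 2) ∞ M] [IsManifold (𝓡 2) ∞ N]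
    (h : SmoothOn φ) {x : M} (hx : x ∈ φ.source)
    {Y : Π y : N, TangentSpace (𝓡 2) y}
    (hY : MDifferentiableAt (𝓡 2) ((𝓡 2).prod 𝓘(ℝ, Plane))
      (fun y => (⟨y, Y y⟩ : TangentBundle (𝓡 2) N)) (φ x)) :
    MDifferentiableAt (𝓡 2) ((𝓡 2).prod 𝓘(ℝ, Plane))
      (fun y => (⟨y, VectorField.mpullback (𝓡 2) (𝓡 2) φ Y y⟩ : TangentBundle (𝓡 2) M)) x := by
  exact MDifferentiableAt.mpullback_vectorField hY (h.contMDiffAt hx) (h.isInvertible hx)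
    two_le_infty

end SmoothOn

theorem Plane.mdifferentiableAt_vectorField_iff {Y : Plane → Plane} {z : Plane} :
    MDifferentiableAt (𝓡 2) ((𝓡 2).prod 𝓘(ℝ, Plane))
      (fun y => (⟨y, Y y⟩ : TangentBundle (𝓡 2) Plane)) z ↔ DifferentiableAt ℝ Y z := by
  refine (mdifferentiableAt_section (𝓡 2) (F := Plane) (E := (TangentSpace (𝓡 2) : Plane → Type))
    (fun y => Y y)).trans ?_
  rw [← mdifferentiableAt_iff_differentiableAt]
  simp

/-! ### Vector fields and the connection in a chart -/

namespace AffineSurface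

variable {S T : AffineSurface} {e : OpenPartialHomeomorph S.carrier Plane}

theorem smoothOn_of_mem_charts (he : e ∈ S.charts) : SmoothOn e :=
  ⟨contMDiffOn_of_mem_maximalAtlas he, contMDiffOn_symm_of_mem_maximalAtlas he⟩

theorem mem_charts_of_smoothOn (he : SmoothOn e) : e ∈ S.charts :=
  e.mem_maximalAtlas_of_contMDiffOn he.1 he.2

/-- The coordinates of tangent vectors in the chart `e`. -/
noncomputable def tangentCoord (S : AffineSurface) (e : OpenPartialHomeomorph S.carrier Plane)
    (x : S.carrier) : TangentSpace (𝓡 2) x →L[ℝ] Plane :=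
  mfderiv (𝓡 2) 𝓘(ℝ, Plane) e x

/-- The coordinate representation of a vector field in the chart `e`. -/
noncomputable def fieldCoord (S : AffineSurface) (e : OpenPartialHomeomorph S.carrier Plane)
    (Y : Π x : S.carrier, TangentSpace (𝓡 2) x) (z : Plane) : Plane :=
  S.tangentCoord e (e.symm z) (Y (e.symm z))

theorem tangentCoord_coordField (he : e ∈ S.charts) {x : S.carrier} (hx : x ∈ e.source) (i : Fin 2) :
    S.tangentCoord e x (S.coordField e i x) = EuclideanSpace.single i 1 :=
  (smoothOn_of_mem_charts he).mfderiv_mpullback hx _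

theorem tangentCoord_injective (he : e ∈ S.charts) {x : S.carrier} (hx : x ∈ e.source) :
    Function.Injective (S.tangentCoord e x) :=
  ((smoothOn_of_mem_charts he).mdifferentiable.mfderiv hx).injective

theorem eq_sum_coordField (he : e ∈ S.charts) {x : S.carrier} (hx : x ∈ e.source)
    (v : TangentSpace (𝓡 2) x) : v = S.tangentCoord e x v 0 • S.coordField e 0 x
      + S.tangentCoord e x v 1 • S.coordField e 1 x := by
  apply tangentCoord_injective he hx
  rw [map_add, map_smul, map_smul, tangentCoord_coordField he hx, tangentCoord_coordField he hx]
  exact Plane.eq_sum _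

theorem mdifferentiableAt_coordField (he : e ∈ S.charts) {x : S.carrier} (hx : x ∈ e.source)
    (i : Fin 2) : MDifferentiableAt (𝓡 2) ((𝓡 2).prod 𝓘(ℝ, Plane))
      (fun y => (⟨y, S.coordField e i y⟩ : TangentBundle (𝓡 2) S.carrier)) x :=
  (smoothOn_of_mem_charts he).mdifferentiableAt_mpullback hx
    (Plane.mdifferentiableAt_vectorField_iff.2 (differentiableAt_const _))

/-- The derivatives of `e` and `e.symm` are mutually inverse. The differentiability of the
coordinates of a field thus follows from that of a pullback. -/
theorem fieldCoord_eq_mpullback (he : e ∈ S.charts) (Y : Π x : S.carrier, TangentSpace (𝓡 2) x)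
    {z : Plane} (hz : z ∈ e.target) :
    S.fieldCoord e Y z = VectorField.mpullback (𝓡 2) (𝓡 2) e.symm Y z := by
  have h := (smoothOn_of_mem_charts he).symm.mfderiv_mpullback (x := z) hz Y
  rw [fieldCoord, ← h]
  exact DFunLike.congr_fun ((smoothOn_of_mem_charts he).mdifferentiable.comp_symm_deriv hz) _

theorem differentiableAt_fieldCoord (he : e ∈ S.charts) {x : S.carrier} (hx : x ∈ e.source)
    {Y : Π x : S.carrier, TangentSpace (𝓡 2) x}
    (hY : MDifferentiableAt (𝓡 2) ((𝓡 2).prod 𝓘(ℝ, Plane))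
      (fun y => (⟨y, Y y⟩ : TangentBundle (𝓡 2) S.carrier)) x) :
    DifferentiableAt ℝ (S.fieldCoord e Y) (e x) := by
  have h := (smoothOn_of_mem_charts he).symm.mdifferentiableAt_mpullback (x := e x)
    (e.map_source hx) (Y := Y) (by rwa [e.left_inv hx])
  refine (Plane.mdifferentiableAt_vectorField_iff.1 h).congr_of_eventuallyEq ?_
  filter_upwards [e.open_target.mem_nhds (e.map_source hx)] with z hz
  exact fieldCoord_eq_mpullback he Y hz

/-- The covariant derivative in the coordinates of the chart `e`. -/
theorem tangentCoord_conn (he : e ∈ S.charts) {x : S.carrier} (hx : x ∈ e.source)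
    {Y : Π x : S.carrier, TangentSpace (𝓡 2) x}
    (hY : MDifferentiableAt (𝓡 2) ((𝓡 2).prod 𝓘(ℝ, Plane))
      (fun y => (⟨y, Y y⟩ : TangentBundle (𝓡 2) S.carrier)) x) (v : TangentSpace (𝓡 2) x) :
    S.tangentCoord e x (S.conn Y x v) =
      fderiv ℝ (S.fieldCoord e Y) (e x) (S.tangentCoord e x v) +
        (S.christoffel e x).toBilin (S.tangentCoord e x v) (S.tangentCoord e x (Y x)) := by
  let h : Fin 2 → S.carrier → ℝ := fun j y => S.fieldCoord e Y (e y) j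
  have hd := differentiableAt_fieldCoord he hx hY
  have hh : ∀ j, HasMFDerivAt (𝓡 2) 𝓘(ℝ, ℝ) (h j) x
      ((EuclideanSpace.proj (𝕜 := ℝ) j ∘L fderiv ℝ (S.fieldCoord e Y) (e x)) ∘L S.tangentCoord e x) := by
    intro j
    have h1 : HasFDerivAt (fun z => S.fieldCoord e Y z j)
        (EuclideanSpace.proj (𝕜 := ℝ) j ∘L fderiv ℝ (S.fieldCoord e Y) (e x)) (e x) :=
      (EuclideanSpace.proj (𝕜 := ℝ) j).hasFDerivAt.comp (e x) hd.hasFDerivAt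
    exact h1.hasMFDerivAt.comp x
      ((smoothOn_of_mem_charts he).mdifferentiable.mdifferentiableAt hx).hasMFDerivAt
  -- Near `x` the field is a combination of the coordinate fields with coefficients `h j`; locality
  -- and the Leibniz rule then compute its covariant derivative.
  have hY' : ∀ᶠ y in 𝓝 x, Y y = (h 0 • S.coordField e 0 + h 1 • S.coordField e 1) y := by
    filter_upwards [e.open_source.mem_nhds hx] with y hy
    rw [eq_sum_coordField he hy (Y y)]
    simp only [h, fieldCoord, Pi.add_apply, Pi.smul_apply']
    rw [e.left_inv hy]
  have hc : ∀ j, MDifferentiableAt (𝓡 2) ((𝓡 2).prod 𝓘(ℝ, Plane))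
      (fun y => (⟨y, (h j • S.coordField e j) y⟩ : TangentBundle (𝓡 2) S.carrier)) x := fun j =>
    (hh j).mdifferentiableAt.smul_section (mdifferentiableAt_coordField he hx j)
  have cov := S.conn.isCovariantDerivativeOn (s := Set.univ)
  have hdh : ∀ j, mvfderiv (𝓡 2) (h j) x v =
      fderiv ℝ (S.fieldCoord e Y) (e x) (S.tangentCoord e x v) j := by
    intro j
    rw [mvfderiv, (hh j).mfderiv]
    rfl
  have hx' : ∀ j, h j x = S.tangentCoord e x (Y x) j := by
    intro j
    simp only [h, fieldCoord]
    rw [e.left_inv hx]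
  have hG : ∀ i j k, S.tangentCoord e x (S.conn (S.coordField e j) x (S.coordField e i x)) k =
      S.christoffel e x i j k := fun i j k => rfl
  have hv : ∀ j k, S.tangentCoord e x (S.conn (S.coordField e j) x v) k =
      S.tangentCoord e x v 0 * S.christoffel e x 0 j k +
      S.tangentCoord e x v 1 * S.christoffel e x 1 j k := by
    intro j k
    conv_lhs => rw [eq_sum_coordField he hx v]
    simp [hG]
  rw [cov.congr_of_eventuallyEq hY (mdifferentiableAt_add_section (hc 0) (hc 1)) Filter.univ_mem hY',
    cov.add (hc 0) (hc 1), cov.leibniz (mdifferentiableAt_coordField he hx 0) (hh 0).mdifferentiableAt,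
    cov.leibniz (mdifferentiableAt_coordField he hx 1) (hh 1).mdifferentiableAt]
  ext k
  simp [hv, hdh, hx', tangentCoord_coordField he hx, Christoffel.toBilin_apply]
  fin_cases k <;> simp <;> ring

end AffineSurface

/-! ### Affine diffeomorphisms in coordinates -/

namespace SmoothOn

variable {ψ : OpenPartialHomeomorph Plane Plane}

theorem contDiffAt (h : SmoothOn ψ) {z : Plane} (hz : z ∈ ψ.source) : ContDiffAt ℝ ∞ ψ z :=
  (h.contMDiffAt hz).contDiffAt

theorem isInvertible_fderiv (h : SmoothOn ψ) {z : Plane} (hz : z ∈ ψ.source) :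
    (fderiv ℝ ψ z).IsInvertible := by
  rw [← mfderiv_eq_fderiv]
  exact h.isInvertible hz

end SmoothOn

namespace AffineSurface

variable {S T : AffineSurface} {φ : OpenPartialHomeomorph S.carrier T.carrier}
  {e : OpenPartialHomeomorph S.carrier Plane} {f : OpenPartialHomeomorph T.carrier Plane}

/-- The local diffeomorphism `φ` written in the charts `e` and `f`. -/
def inCharts (φ : OpenPartialHomeomorph S.carrier T.carrier)
    (e : OpenPartialHomeomorph S.carrier Plane) (f : OpenPartialHomeomorph T.carrier Plane) :
    OpenPartialHomeomorph Plane Plane :=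
  (e.symm.trans φ).trans f

theorem mem_inCharts_source {x : S.carrier} (hx : x ∈ e.source) (hxφ : x ∈ φ.source)
    (hxf : φ x ∈ f.source) : e x ∈ (inCharts φ e f).source := by
  simp [inCharts, hx, hxφ, hxf]

theorem of_mem_inCharts_source {z : Plane} (hz : z ∈ (inCharts φ e f).source) :
    z ∈ e.target ∧ e.symm z ∈ φ.source ∧ φ (e.symm z) ∈ f.source := by
  simp only [inCharts, OpenPartialHomeomorph.trans_source, OpenPartialHomeomorph.symm_source,
    OpenPartialHomeomorph.coe_trans, Set.mem_inter_iff, Set.mem_preimage, Function.comp_apply] at hz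
  tauto

theorem IsAffineDiffeo.smoothOn (h : IsAffineDiffeo S T φ) : SmoothOn φ := ⟨h.1, h.2.1⟩

theorem smoothOn_inCharts (hφ : SmoothOn φ) (he : e ∈ S.charts) (hf : f ∈ T.charts) :
    SmoothOn (inCharts φ e f) :=
  ((smoothOn_of_mem_charts he).symm.trans hφ).trans (smoothOn_of_mem_charts hf)

theorem fderiv_inCharts (hφ : SmoothOn φ) (he : e ∈ S.charts) (hf : f ∈ T.charts)
    {x : S.carrier} (hx : x ∈ e.source) (hxφ : x ∈ φ.source)
    (hxf : φ x ∈ f.source) (v : TangentSpace (𝓡 2) x) :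
    fderiv ℝ (inCharts φ e f) (e x) (S.tangentCoord e x v) =
      T.tangentCoord f (φ x) (mfderiv (𝓡 2) (𝓡 2) φ x v) := by
  have he' := smoothOn_of_mem_charts he
  have hf' := smoothOn_of_mem_charts hf
  have h1 := (smoothOn_inCharts hφ he hf).mdifferentiable.mdifferentiableAt
    (mem_inCharts_source hx hxφ hxf)
  have h2 := mfderiv_comp x h1 (he'.mdifferentiable.mdifferentiableAt hx)
  have h3 : (inCharts φ e f) ∘ e =ᶠ[𝓝 x] φ.trans f := by
    filter_upwards [e.open_source.mem_nhds hx] with y hy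
    simp [inCharts, e.left_inv hy]
  rw [h3.mfderiv_eq, hφ.mfderiv_trans hf' hxφ hxf] at h2
  have h4 := DFunLike.congr_fun h2 v
  rw [mfderiv_eq_fderiv] at h4
  exact h4.symm

/-- An affine diffeomorphism, in coordinates, obeys the transformation law of Christoffel
symbols. -/
theorem IsAffineDiffeo.transformsAt (h : IsAffineDiffeo S T φ) (he : e ∈ S.charts)
    (hf : f ∈ T.charts) {x : S.carrier} (hx : x ∈ e.source) (hxφ : x ∈ φ.source)
    (hxf : φ x ∈ f.source) :
    TransformsAt (inCharts φ e f) (fun z => S.christoffel e (e.symm z)) (T.christoffel f (φ x))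
      (e x) := by
  intro w u
  have hφ := h.smoothOn
  have he' := smoothOn_of_mem_charts he
  have hf' := smoothOn_of_mem_charts hf
  have hψ := smoothOn_inCharts hφ he hf
  have hz := mem_inCharts_source hx hxφ hxf
  set ψ := inCharts φ e f with hψd
  set c := fderiv ℝ ψ (e x) u with hc
  obtain ⟨v, rfl⟩ : ∃ v, S.tangentCoord e x v = w := (he'.mdifferentiable.mfderiv hx).surjective w
  -- The test field has constant coordinates `c = Dψ u` on the target, so its own derivative drops
  -- out. Its pullback `Z` has value `u` at the point in coordinates.
  let Y : Π y : T.carrier, TangentSpace (𝓡 2) y :=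
    VectorField.mpullback (𝓡 2) (𝓡 2) f (fun _ => (c : Plane))
  have hY : MDifferentiableAt (𝓡 2) ((𝓡 2).prod 𝓘(ℝ, Plane))
      (fun y => (⟨y, Y y⟩ : TangentBundle (𝓡 2) T.carrier)) (φ x) :=
    hf'.mdifferentiableAt_mpullback hxf
      (Plane.mdifferentiableAt_vectorField_iff.2 (differentiableAt_const _))
  have hYc : ∀ y ∈ f.source, T.tangentCoord f y (Y y) = c := fun y hy => hf'.mfderiv_mpullback hy _
  have hZ := hφ.mdifferentiableAt_mpullback hxφ hY
  set Z := VectorField.mpullback (𝓡 2) (𝓡 2) φ Y with hZd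
  have hU := differentiableAt_fieldCoord he hx hZ
  have hUc : ∀ z ∈ ψ.source, fderiv ℝ ψ z (S.fieldCoord e Z z) = c := by
    intro z hz
    obtain ⟨h1, h2, h3⟩ := of_mem_inCharts_source hz
    have := fderiv_inCharts hφ he hf (e.map_target h1) h2 h3 (Z (e.symm z))
    rw [e.right_inv h1, hφ.mfderiv_mpullback h2, hYc _ h3] at this
    exact this
  have hUx : S.fieldCoord e Z (e x) = S.tangentCoord e x (Z x) := by
    rw [fieldCoord, e.left_inv hx]
  have hUu : S.tangentCoord e x (Z x) = u := by
    obtain ⟨J, hJ⟩ := hψ.isInvertible_fderiv hz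
    have := hUc _ hz
    rw [hUx, hc, ← hJ] at this
    exact J.injective this
  have dJ : HasFDerivAt (fderiv ℝ ψ) (fderiv ℝ (fderiv ℝ ψ) (e x)) (e x) :=
    (((hψ.contDiffAt hz).fderiv_right (m := ∞) (by simp)).differentiableAt (by simp)).hasFDerivAt
  -- Differentiating `Dψ_z (Z z) = c` trades the derivative of the coordinates of `Z` for `D²ψ`,
  -- which produces the inhomogeneous term of the law.
  have hD := (dJ.clm_apply hU.hasFDerivAt).unique
    ((hasFDerivAt_const c (e x)).congr_of_eventuallyEq (by
      filter_upwards [ψ.open_source.mem_nhds hz] with z hz using hUc z hz))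
  have hD' := congrArg (fun L => L (S.tangentCoord e x v)) hD
  simp only [add_apply, ContinuousLinearMap.comp_apply,
    ContinuousLinearMap.flip_apply, zero_apply] at hD'
  rw [hUx, hUu] at hD'
  have hA := congrArg (T.tangentCoord f (φ x)) (h.2.2 x hxφ Y hY v)
  have hVc : fderiv ℝ (T.fieldCoord f Y) (f (φ x)) = 0 := by
    rw [Filter.EventuallyEq.fderiv_eq (f := fun _ => c), fderiv_fun_const]
    · rfl
    · filter_upwards [f.open_target.mem_nhds (f.map_source hxf)] with z hz
      exact hYc _ (f.map_target hz)
  rw [← fderiv_inCharts hφ he hf hx hxφ hxf, tangentCoord_conn he hx hZ, tangentCoord_conn hf hxf hY,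
    hVc, hYc _ hxf, hUu, ← fderiv_inCharts hφ he hf hx hxφ hxf, map_add] at hA
  simp only [zero_apply, zero_add] at hA
  rw [← hψd] at hA
  simp only [e.left_inv hx]
  rw [← hA, ← add_assoc, add_comm (fderiv ℝ (fderiv ℝ ψ) (e x) _ u), hD', zero_add]

end AffineSurface

/-! ### Affine maps, Type 𝒜 charts and torsion -/

theorem Plane.mlieBracket_eq (X Y : Π z : Plane, TangentSpace (𝓡 2) z) (z : Plane) :
    VectorField.mlieBracket (𝓡 2) X Y z =
      VectorField.lieBracket ℝ (X : Plane → Plane) (Y : Plane → Plane) z := by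
  rw [← VectorField.mlieBracketWithin_univ, VectorField.mlieBracketWithin_eq_lieBracketWithin]
  exact congrFun (VectorField.lieBracketWithin_univ (𝕜 := ℝ) (E := Plane)) z

/-- The affine map of the plane with linear part `g` that takes `a` to `b`. -/
noncomputable def planeAffine (g : GLTwo) (a b : Plane) : Plane ≃ₜ Plane where
  toFun z := g.toCLM (z - a) + b
  invFun z := (g⁻¹ : GLTwo).toCLM (z - b) + a
  left_inv z := by simp [GLTwo.inv_toCLM_apply]
  right_inv z := by simp [GLTwo.toCLM_inv_apply]
  continuous_toFun := by fun_prop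
  continuous_invFun := by fun_prop

theorem planeAffine_apply (g : GLTwo) (a b z : Plane) :
    planeAffine g a b z = g.toCLM (z - a) + b := rfl

theorem planeAffine_symm (g : GLTwo) (a b : Plane) :
    (planeAffine g a b).symm = planeAffine g⁻¹ b a := by
  ext1 z; rfl

theorem hasFDerivAt_planeAffine (g : GLTwo) (a b z : Plane) :
    HasFDerivAt (planeAffine g a b) g.toCLM z := by
  have : HasFDerivAt (fun z => g.toCLM (z - a) + b) (g.toCLM ∘L ContinuousLinearMap.id ℝ Plane) z :=
    (g.toCLM.hasFDerivAt.comp z ((hasFDerivAt_id z).sub_const a)).add_const b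
  exact this

theorem contDiff_planeAffine (g : GLTwo) (a b : Plane) :
    ContDiff ℝ ∞ (planeAffine g a b) :=
  (g.toCLM.contDiff.comp (contDiff_id.sub contDiff_const)).add contDiff_const

theorem smoothOn_planeAffine (g : GLTwo) (a b : Plane) :
    SmoothOn (planeAffine g a b).toOpenPartialHomeomorph := by
  refine ⟨(contDiff_planeAffine g a b).contMDiff.contMDiffOn, ?_⟩
  have := (contDiff_planeAffine g⁻¹ b a).contMDiff.contMDiffOn (s := Set.univ)
  rwa [← planeAffine_symm] at this

namespace AffineSurface

variable {S T : AffineSurface} {φ : OpenPartialHomeomorph S.carrier T.carrier}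
  {e : OpenPartialHomeomorph S.carrier Plane} {f : OpenPartialHomeomorph T.carrier Plane}

theorem isAffineDiffeo_refl (S : AffineSurface) :
    IsAffineDiffeo S S (OpenPartialHomeomorph.refl S.carrier) := by
  refine ⟨contMDiffOn_id, contMDiffOn_id, fun x _ Y _ v => ?_⟩
  have h1 : ((OpenPartialHomeomorph.refl S.carrier : S.carrier → S.carrier)) = id := rfl
  rw [h1, VectorField.mpullback_id, mfderiv_id]
  rfl

theorem IsTypeAChart.mem_W {p q : ℕ} {Γ : Christoffel} (h : S.IsTypeAChart e Γ)
    (hne : e.source.Nonempty) (hS : S.HasRicciSignature p q) : Γ ∈ Christoffel.W p q := by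
  obtain ⟨x, hx⟩ := hne
  have := hS e h.1 x hx
  rw [symRicci_congr (G' := fun _ => Γ), symRicci_const Γ _ 0] at this
  · exact this
  · filter_upwards [e.open_target.mem_nhds (e.map_source hx)] with z hz
    exact h.2 _ (e.map_target hz)

/-- Rigidity transferred to surfaces. The matrix is identified as the Jacobian so that the oriented
cases can read off the sign of its determinant. -/
theorem IsAffineDiffeo.exists_smul_eq (h : IsAffineDiffeo S T φ) {Γ Γ' : Christoffel}
    (he : S.IsTypeAChart e Γ) (hf : T.IsTypeAChart f Γ') {p q : ℕ} (hΓ' : Γ' ∈ Christoffel.W p q)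
    {x : S.carrier} (hx : x ∈ e.source) (hxφ : x ∈ φ.source) (hxf : φ x ∈ f.source) :
    ∃ g : GLTwo, g.toCLM = fderiv ℝ (inCharts φ e f) (e x) ∧ Γ' = g • Γ := by
  have hψ := smoothOn_inCharts h.smoothOn he.1 hf.1
  have hs := (inCharts φ e f).open_source.mem_nhds (mem_inCharts_source hx hxφ hxf)
  refine Christoffel.eq_smul_of_transforms ?_ ?_ ?_ hΓ'.1
  · filter_upwards [hs] with z hz using hψ.contDiffAt hz
  · filter_upwards [hs] with z hz using hψ.isInvertible_fderiv hz
  · filter_upwards [hs] with z hz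
    obtain ⟨h1, h2, h3⟩ := of_mem_inCharts_source hz
    have := h.transformsAt he.1 hf.1 (e.map_target h1) h2 h3
    rw [e.right_inv h1, hf.2 _ h3] at this
    intro u v
    exact (this u v).trans (by simp only [he.2 _ (e.map_target h1)])

/-- A change of coordinates with constant linear part is affine when it matches the Christoffel
symbols. -/
theorem isAffineDiffeo_of_fderiv_eq (hφ : SmoothOn φ) (he : e ∈ S.charts) (hf : f ∈ T.charts)
    (g : GLTwo) (hsrc : ∀ x ∈ φ.source, x ∈ e.source ∧ φ x ∈ f.source)
    (hg : ∀ x ∈ φ.source, fderiv ℝ (inCharts φ e f) (e x) = g.toCLM)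
    (hΓ : ∀ x ∈ φ.source, T.christoffel f (φ x) = g • S.christoffel e x) :
    IsAffineDiffeo S T φ := by
  refine ⟨hφ.1, hφ.2, fun x hxφ Y hY v => ?_⟩
  obtain ⟨hx, hxf⟩ := hsrc x hxφ
  have hψ := smoothOn_inCharts hφ he hf
  have hz := mem_inCharts_source hx hxφ hxf
  have hd : ∀ x ∈ φ.source, ∀ v, T.tangentCoord f (φ x) (mfderiv (𝓡 2) (𝓡 2) φ x v) =
      g.toCLM (S.tangentCoord e x v) := by
    intro x hxφ v
    rw [← hg x hxφ, fderiv_inCharts hφ he hf (hsrc x hxφ).1 hxφ (hsrc x hxφ).2]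
  apply tangentCoord_injective hf hxf
  have hZ := hφ.mdifferentiableAt_mpullback hxφ hY
  have hU := (differentiableAt_fieldCoord he hx hZ).hasFDerivAt
  have hV := (differentiableAt_fieldCoord hf hxf hY).hasFDerivAt
  have hφx : inCharts φ e f (e x) = f (φ x) := by simp [inCharts, e.left_inv hx]
  rw [← hφx] at hV
  have hψd := ((hψ.contDiffAt hz).differentiableAt (by simp)).hasFDerivAt
  rw [hg x hxφ] at hψd
  -- In coordinates the field `Y` composed with `ψ` equals `g` applied to its pullback; as `g` is
  -- constant, differentiation yields no second-order term.
  have key := (hV.comp (e x) hψd).unique ((g.toCLM.hasFDerivAt.comp (e x) hU).congr_of_eventuallyEq (by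
    filter_upwards [(inCharts φ e f).open_source.mem_nhds hz] with z hz
    obtain ⟨h1, h2, h3⟩ := of_mem_inCharts_source hz
    simp only [Function.comp_apply, fieldCoord]
    rw [← hd _ h2, hφ.mfderiv_mpullback h2]
    simp only [inCharts, OpenPartialHomeomorph.coe_trans, Function.comp_apply]
    rw [f.left_inv h3]
    rfl))
  have key' := congrArg (fun L => L (S.tangentCoord e x v)) key
  simp only [ContinuousLinearMap.comp_apply] at key'
  rw [hd x hxφ, tangentCoord_conn he hx hZ, tangentCoord_conn hf hxf hY, hd x hxφ, map_add, ← key',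
    hΓ x hxφ, ← hφx, ← hφ.mfderiv_mpullback hxφ Y, hd x hxφ, Christoffel.toBilin_smul]

/-- The local diffeomorphism that is affine in the charts `e` and `f`. -/
noncomputable def affineGlue (e : OpenPartialHomeomorph S.carrier Plane)
    (f : OpenPartialHomeomorph T.carrier Plane) (g : GLTwo) (P : S.carrier) (Q : T.carrier) :
    OpenPartialHomeomorph S.carrier T.carrier :=
  (e.trans (planeAffine g (e P) (f Q)).toOpenPartialHomeomorph).trans f.symm

theorem affineGlue_apply (e : OpenPartialHomeomorph S.carrier Plane)
    (f : OpenPartialHomeomorph T.carrier Plane) (g : GLTwo) (P : S.carrier) (Q : T.carrier)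
    (x : S.carrier) : affineGlue e f g P Q x = f.symm (planeAffine g (e P) (f Q) (e x)) := rfl

theorem of_mem_affineGlue_source {g : GLTwo} {P : S.carrier} {Q : T.carrier} {x : S.carrier}
    (hx : x ∈ (affineGlue e f g P Q).source) :
    x ∈ e.source ∧ planeAffine g (e P) (f Q) (e x) ∈ f.target := by
  simpa [affineGlue] using hx

theorem mem_affineGlue_source {g : GLTwo} {P : S.carrier} {Q : T.carrier} (hP : P ∈ e.source)
    (hQ : Q ∈ f.source) : P ∈ (affineGlue e f g P Q).source := by
  simp [affineGlue, hP, hQ, planeAffine_apply]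

theorem affineGlue_base {g : GLTwo} {P : S.carrier} {Q : T.carrier} (hQ : Q ∈ f.source) :
    affineGlue e f g P Q P = Q := by
  simp [affineGlue_apply, planeAffine_apply, hQ]

theorem smoothOn_affineGlue (he : e ∈ S.charts) (hf : f ∈ T.charts) (g : GLTwo) (P : S.carrier)
    (Q : T.carrier) : SmoothOn (affineGlue e f g P Q) :=
  ((smoothOn_of_mem_charts he).trans (smoothOn_planeAffine _ _ _)).trans
    (smoothOn_of_mem_charts hf).symm

theorem fderiv_inCharts_affineGlue {g : GLTwo} {P : S.carrier} {Q : T.carrier} {x : S.carrier}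
    (hx : x ∈ (affineGlue e f g P Q).source) :
    fderiv ℝ (inCharts (affineGlue e f g P Q) e f) (e x) = g.toCLM := by
  obtain ⟨h1, h2⟩ := of_mem_affineGlue_source hx
  refine ((hasFDerivAt_planeAffine g (e P) (f Q) (e x)).congr_of_eventuallyEq ?_).fderiv
  have hc := (planeAffine g (e P) (f Q)).continuous.continuousAt.preimage_mem_nhds
    (f.open_target.mem_nhds h2)
  filter_upwards [e.open_target.mem_nhds (e.map_source h1), hc] with z hz hz'
  simp only [inCharts, OpenPartialHomeomorph.coe_trans, Function.comp_apply, affineGlue_apply]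
  rw [e.right_inv hz, f.right_inv hz']

theorem isAffineDiffeo_affineGlue {Γ : Christoffel} {g : GLTwo} (he : S.IsTypeAChart e Γ)
    (hf : T.IsTypeAChart f (g • Γ)) (P : S.carrier) (Q : T.carrier) :
    IsAffineDiffeo S T (affineGlue e f g P Q) := by
  have hsrc : ∀ x ∈ (affineGlue e f g P Q).source, x ∈ e.source ∧ affineGlue e f g P Q x ∈ f.source :=
    fun x hx => ⟨(of_mem_affineGlue_source hx).1, f.map_target (of_mem_affineGlue_source hx).2⟩
  refine isAffineDiffeo_of_fderiv_eq (smoothOn_affineGlue he.1 hf.1 g P Q) he.1 hf.1 g hsrc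
    (fun x hx => fderiv_inCharts_affineGlue hx) fun x hx => ?_
  rw [hf.2 _ (hsrc x hx).2, he.2 _ (hsrc x hx).1]

theorem IsTypeAChart.restr {Γ : Christoffel} (he : S.IsTypeAChart e Γ) {U : Set S.carrier}
    (hU : IsOpen U) : S.IsTypeAChart (e.restrOpen U hU) Γ := by
  have h := smoothOn_of_mem_charts he.1
  refine ⟨mem_charts_of_smoothOn ⟨h.1.mono ?_, h.2.mono ?_⟩, fun x hx => he.2 x ?_⟩
  · intro x hx; simp at hx; exact hx.1
  · intro x hx; simp at hx; exact hx.1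
  · simp at hx; exact hx.1

/-- The identity map read from `e` to the new chart is affine with linear part `g`, so the
transformation law has no second-order term. Its use is to reverse the orientation of a chart. -/
theorem IsTypeAChart.trans_affine {Γ : Christoffel} (he : S.IsTypeAChart e Γ) (g : GLTwo) :
    S.IsTypeAChart (e.trans (planeAffine g 0 0).toOpenPartialHomeomorph) (g • Γ) := by
  set e' := e.trans (planeAffine g 0 0).toOpenPartialHomeomorph with he'
  have hch : e' ∈ S.charts := mem_charts_of_smoothOn
    ((smoothOn_of_mem_charts he.1).trans (smoothOn_planeAffine _ _ _))
  refine ⟨hch, fun x hx' => ?_⟩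
  have hx : x ∈ e.source := by simpa [he'] using hx'
  have h := (isAffineDiffeo_refl S).transformsAt he.1 hch (x := x) hx trivial hx'
  have hev : inCharts (OpenPartialHomeomorph.refl S.carrier) e e' =ᶠ[𝓝 (e x)]
      planeAffine g 0 0 := by
    filter_upwards [e.open_target.mem_nhds (e.map_source hx)] with z hz
    simp [inCharts, he', e.right_inv hz]
  have h1 : fderiv ℝ (inCharts (OpenPartialHomeomorph.refl S.carrier) e e') =ᶠ[𝓝 (e x)]
      fun _ => g.toCLM := by
    filter_upwards [hev.eventually_nhds] with z hz
    rw [Filter.EventuallyEq.fderiv_eq hz, (hasFDerivAt_planeAffine g 0 0 z).fderiv]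
  refine Christoffel.eq_smul_of_toBilin fun u v => ?_
  have := h u v
  rw [h1.fderiv_eq, h1.self_of_nhds] at this
  simp only [e.left_inv hx, he.2 x hx] at this
  simpa using this

/-- A transition map is the identity of the surface read in two charts, and the identity is an
affine diffeomorphism. -/
theorem exists_smul_eq_of_mem_source {e' : OpenPartialHomeomorph S.carrier Plane} {Γ Γ' : Christoffel}
    {p q : ℕ} (hS : S.HasRicciSignature p q) (he : S.IsTypeAChart e Γ) (he' : S.IsTypeAChart e' Γ')
    {x : S.carrier} (hx : x ∈ e.source) (hx' : x ∈ e'.source) :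
    ∃ g : GLTwo, g.toCLM = fderiv ℝ (e' ∘ e.symm) (e x) ∧ Γ' = g • Γ :=
  (isAffineDiffeo_refl S).exists_smul_eq he he' (he'.mem_W ⟨x, hx'⟩ hS) hx trivial hx'

/-- Coordinate fields are pullbacks of constant fields, so they commute and zero torsion gives
`∇_{∂_i} ∂_j = ∇_{∂_j} ∂_i`. -/
theorem IsTypeAChart.symm_of_isTorsionFree {Γ : Christoffel} (h : S.IsTypeAChart e Γ)
    (hne : e.source.Nonempty) (hS : S.IsTorsionFree) (i j k : Fin 2) : Γ i j k = Γ j i k := by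
  obtain ⟨x, hx⟩ := hne
  have hs := smoothOn_of_mem_charts h.1
  have h0 := (S.conn.torsion_eq_zero_iff.1 hS) (mdifferentiableAt_coordField h.1 hx i)
    (mdifferentiableAt_coordField h.1 hx j)
  have hc : ∀ c : Plane, MDifferentiableAt (𝓡 2) ((𝓡 2).prod 𝓘(ℝ, Plane))
      (fun y => (⟨y, c⟩ : TangentBundle (𝓡 2) Plane)) (e x) := fun c =>
    Plane.mdifferentiableAt_vectorField_iff.2 (differentiableAt_const c)
  have hb : VectorField.mlieBracket (𝓡 2) (S.coordField e i) (S.coordField e j) x = 0 := by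
    have : IsManifold (𝓡 2) (minSmoothness ℝ 2) S.carrier :=
      IsManifold.of_le (n := ∞) minSmoothness_two_le_infty
    have h2 := VectorField.mpullback_mlieBracket (hc (EuclideanSpace.single i 1))
      (hc (EuclideanSpace.single j 1)) (hs.contMDiffAt hx) minSmoothness_two_le_infty
    refine h2.symm.trans ((congrArg _ ((Plane.mlieBracket_eq _ _ _).trans ?_)).trans (map_zero _))
    simp [VectorField.lieBracket]
    rfl
  rw [hb, sub_eq_zero] at h0
  rw [← h.2 x hx]
  exact congrArg (fun v => S.tangentCoord e x v k) h0

end AffineSurface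

/-! ### The model surfaces -/

/-- The connection `∇_v Y = DY v + Γ(v, Y)` of the plane. -/
noncomputable def Christoffel.conn (Γ : Christoffel) :
    CovariantDerivative (𝓡 2) Plane (TangentSpace (𝓡 2) : Plane → Type) where
  toFun Y x := (fderiv ℝ (fun z => (Y z : Plane)) x + Γ.toBilin.flip (Y x) : Plane →L[ℝ] Plane)
  isCovariantDerivativeOnUniv := by
    constructor
    · intro Y Z x hY hZ _
      have hY' : DifferentiableAt ℝ (fun z => (Y z : Plane)) x :=
        Plane.mdifferentiableAt_vectorField_iff.1 hY
      have hZ' : DifferentiableAt ℝ (fun z => (Z z : Plane)) x :=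
        Plane.mdifferentiableAt_vectorField_iff.1 hZ
      have h1 := fderiv_fun_add hY' hZ'
      have h2 := Γ.toBilin.flip.map_add (Y x) (Z x)
      exact (congrArg₂ (· + ·) h1 h2).trans (add_add_add_comm _ _ _ _)
    · intro Y g x hY hg _
      have hY' : DifferentiableAt ℝ (fun z => (Y z : Plane)) x :=
        Plane.mdifferentiableAt_vectorField_iff.1 hY
      have hg' := hg.differentiableAt
      have h1 := fderiv_fun_smul hg' hY'
      have h2 := Γ.toBilin.flip.map_smul (g x) (Y x)
      have h3 : mvfderiv (𝓡 2) g x = fderiv ℝ g x := by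
        rw [mvfderiv, mfderiv_eq_fderiv]; rfl
      rw [h3]
      refine (congrArg₂ (· + ·) h1 h2).trans ?_
      refine ContinuousLinearMap.ext fun v => ?_
      have h4 : ∀ (c d : ℝ) (A B C : Plane), (c • A + d • B) + c • C = c • (A + C) + d • B := by
        intro c d A B C
        rw [smul_add, add_right_comm]
      exact h4 (g x) (fderiv ℝ g x v) (fderiv ℝ (fun z => (Y z : Plane)) x v) (Y x)
        (Γ.toBilin.flip (Y x) v)

theorem Christoffel.conn_apply (Γ : Christoffel) (Y : Plane → Plane) (x v : Plane) :
    Γ.conn Y x v = fderiv ℝ Y x v + Γ.toBilin v (Y x) := rfl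

theorem Christoffel.conn_const (Γ : Christoffel) (c x v : Plane) :
    Γ.conn (fun _ => c) x v = Γ.toBilin v c := by
  have h := Γ.conn_apply (fun _ => c) x v
  rw [fderiv_fun_const, Pi.zero_apply, zero_apply, zero_add] at h
  exact h

instance Christoffel.contMDiff_conn (Γ : Christoffel) :
    CovariantDerivative.ContMDiffCovariantDerivative Γ.conn ∞ := by
  refine ⟨⟨fun {Y} hY x _ => ?_⟩⟩
  have hY' : ContDiff ℝ ∞ (fun z => (Y z : Plane)) :=
    contMDiff_vectorSpace_iff_contDiff.1 (contMDiffOn_univ.1 hY)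
  have h : ContDiff ℝ ∞ (fun x => fderiv ℝ (fun z => (Y z : Plane)) x + Γ.toBilin.flip (Y x)) :=
    (hY'.fderiv_right (by simp)).add (Γ.toBilin.flip.contDiff.comp hY')
  apply ContMDiffAt.contMDiffWithinAt
  rw [contMDiffAt_hom_bundle]
  refine ⟨contMDiffAt_id, ?_⟩
  refine (h.contMDiff x).congr_of_eventuallyEq (Filter.Eventually.of_forall fun y => ?_)
  exact inCoordinates_tangent_bundle_core_model_space x y x y _

/-- The plane with constant Christoffel symbols. -/
noncomputable def Christoffel.surface (Γ : Christoffel) : AffineSurface where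
  carrier := Plane
  conn := Γ.conn

namespace Christoffel

theorem surface_isTypeAChart (Γ : Christoffel) :
    Γ.surface.IsTypeAChart (OpenPartialHomeomorph.refl Plane) Γ := by
  refine ⟨Γ.surface.mem_charts_of_smoothOn SmoothOn.refl, fun x _ => ?_⟩
  have hc : ∀ i, Γ.surface.coordField (OpenPartialHomeomorph.refl Plane) i =
      fun _ => (EuclideanSpace.single i (1 : ℝ) : Plane) := fun i =>
    VectorField.mpullback_id (I := 𝓡 2) (M := Plane)
      (V := fun _ => (EuclideanSpace.single i (1 : ℝ) : Plane))
  have hd : Γ.surface.tangentCoord (OpenPartialHomeomorph.refl Plane) x =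
      ContinuousLinearMap.id ℝ Plane := mfderiv_id (I := 𝓡 2) (M := Plane)
  funext i j k
  have h1 : Γ.surface.christoffel (OpenPartialHomeomorph.refl Plane) x i j k =
      Γ.surface.tangentCoord (OpenPartialHomeomorph.refl Plane) x
        (Γ.surface.conn (Γ.surface.coordField (OpenPartialHomeomorph.refl Plane) j) x
          (Γ.surface.coordField (OpenPartialHomeomorph.refl Plane) i x)) k := rfl
  rw [h1, hd, hc, hc, ← toBilin_single Γ i j k]
  exact congrArg (fun v : Plane => v k) (Γ.conn_const _ x _)

theorem surface_isTypeA (Γ : Christoffel) : Γ.surface.IsTypeA :=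
  fun _ => ⟨OpenPartialHomeomorph.refl Plane, Γ, Set.mem_univ _, Γ.surface_isTypeAChart⟩

/-- The signature condition concerns every smooth chart, where the symbols need not be constant. The
identity, read from such a chart into the standard one, reduces it to the constant form of `Γ`. -/
theorem surface_hasRicciSignature {Γ : Christoffel} {p q : ℕ} (h : Γ ∈ W p q) :
    Γ.surface.HasRicciSignature p q := by
  intro e he x hx
  have hr := Γ.surface_isTypeAChart
  have hφ := AffineSurface.isAffineDiffeo_refl Γ.surface
  set φ := OpenPartialHomeomorph.refl Γ.surface.carrier
  set ψ := AffineSurface.inCharts φ e (OpenPartialHomeomorph.refl Plane) with hψd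
  have hψ : SmoothOn ψ := AffineSurface.smoothOn_inCharts hφ.smoothOn he hr.1
  have hz : e x ∈ ψ.source := AffineSurface.mem_inCharts_source hx trivial trivial
  have hs := ψ.open_source.mem_nhds hz
  have hT : ∀ z ∈ ψ.source, TransformsAt ψ (fun z => Γ.surface.christoffel e (e.symm z)) Γ z := by
    intro z hz
    obtain ⟨h1, h2, h3⟩ := AffineSurface.of_mem_inCharts_source hz
    have := hφ.transformsAt he hr.1 (e.map_target h1) h2 h3
    rwa [e.right_inv h1, hr.2 _ h3] at this
  refine HasSignature.of_transforms (hψ.contDiffAt hz) (fun i j k => ?_)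
    (hψ.isInvertible_fderiv hz) (by filter_upwards [hs] with z hz using hT z hz) h
  have hJ : ContDiffAt ℝ ∞ (fderiv ℝ ψ) (e x) := (hψ.contDiffAt hz).fderiv_right (by simp)
  have hJJ : ContDiffAt ℝ ∞ (fderiv ℝ (fderiv ℝ ψ)) (e x) := hJ.fderiv_right (by simp)
  have dJ := hJ.differentiableAt (by simp)
  have dJJ := hJJ.differentiableAt (by simp)
  -- The symbols in the chart `e` are differentiable because the law can be solved for them: `G(u,
  -- v) = (Dψ)⁻¹ (D²ψ(u, v) + Γ(Dψ u, Dψ v))`, and inversion of linear maps is smooth.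
  have dI : DifferentiableAt ℝ (fun z => (fderiv ℝ ψ z).inverse) (e x) := by
    obtain ⟨E, hE⟩ := hψ.isInvertible_fderiv hz
    have h1 : DifferentiableAt ℝ (ContinuousLinearMap.inverse : (Plane →L[ℝ] Plane) → _)
        (fderiv ℝ ψ (e x)) := by
      rw [← hE]
      exact (contDiffAt_map_inverse E (n := 1)).differentiableAt (by simp)
    exact h1.comp (e x) dJ
  have hd : DifferentiableAt ℝ (fun z => (fderiv ℝ ψ z).inverse
      (fderiv ℝ (fderiv ℝ ψ) z (EuclideanSpace.single i 1) (EuclideanSpace.single j 1) +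
        Γ.toBilin (fderiv ℝ ψ z (EuclideanSpace.single i 1))
          (fderiv ℝ ψ z (EuclideanSpace.single j 1)))) (e x) := by
    fun_prop
  refine ((EuclideanSpace.proj (𝕜 := ℝ) k).differentiableAt.comp (e x) hd).congr_of_eventuallyEq ?_
  filter_upwards [hs] with z hz
  simp only [Function.comp_apply]
  rw [hT z hz, (hψ.isInvertible_fderiv hz).inverse_apply_self]
  exact (toBilin_single _ i j k).symm

theorem surface_isTorsionFree {Γ : Christoffel} (h : ∀ i j k, Γ i j k = Γ j i k) :
    Γ.surface.IsTorsionFree := by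
  have hs : ∀ u v, Γ.toBilin u v = Γ.toBilin v u := by
    intro u v
    ext k
    simp only [toBilin_apply, Fin.sum_univ_two, h 1 0]
    ring
  have key : ∀ (X Y : Plane → Plane) (x : Plane), Γ.conn Y x (X x) - Γ.conn X x (Y x) =
      VectorField.lieBracket ℝ X Y x := by
    intro X Y x
    refine (congrArg₂ (fun u v : Plane => u - v) (Γ.conn_apply Y x (X x))
      (Γ.conn_apply X x (Y x))).trans ?_
    rw [hs (Y x) (X x), add_sub_add_right_eq_sub, VectorField.lieBracket]
  refine Γ.surface.conn.torsion_eq_zero_iff.2 fun {X Y x} _ _ => ?_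
  exact (key X Y x).trans (Plane.mlieBracket_eq X Y x).symm

end Christoffel

/-! ### From local invariants to quotients -/

/-- Labels of open sets covering a connected space are equivalent if labels of overlapping sets
are. -/
theorem setoid_of_overlap {X ι α : Type*} [TopologicalSpace X] [PreconnectedSpace X] (s : Setoid α)
    (U : ι → Set X) (hU : ∀ i, IsOpen (U i)) (A : ι → α → Prop)
    (hcov : ∀ x, ∃ i a, x ∈ U i ∧ A i a)
    (hov : ∀ i j a b x, A i a → A j b → x ∈ U i → x ∈ U j → s a b)
    {i j : ι} {a b : α} (hi : A i a) (hj : A j b) (hne : (U i).Nonempty) (hne' : (U j).Nonempty) :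
    s a b := by
  choose c l hc hl using hcov
  -- The class of a chosen label is locally constant, hence constant by connectedness.
  have hF : IsLocallyConstant fun x => (Quotient.mk s (l x)) := by
    rw [IsLocallyConstant.iff_eventually_eq]
    intro x
    filter_upwards [(hU (c x)).mem_nhds (hc x)] with y hy
    exact Quotient.sound (hov _ _ _ _ y (hl y) (hl x) (hc y) hy)
  obtain ⟨x, hx⟩ := hne
  obtain ⟨y, hy⟩ := hne'
  have h1 := hov _ _ _ _ x hi (hl x) hx (hc x)
  have h2 := Quotient.exact (hF.apply_eq_of_preconnectedSpace x y)
  have h3 := hov _ _ _ _ y (hl y) hj (hc y) hy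
  exact s.trans (s.trans h1 h2) h3

/-- A relation classified by an invariant is an equivalence relation, with quotient the set of
values of the invariant. -/
theorem exists_equiv_of_invariant {Str : Type*} {α : Type*} {rel : Str → Str → Prop} (s : Setoid α)
    (Inv : Str → α → Prop) (h1 : ∀ S, ∃ a, Inv S a) (h2 : ∀ a, ∃ S, Inv S a)
    (h3 : ∀ S T a b, Inv S a → Inv T b → (rel S T ↔ s a b)) :
    Equivalence rel ∧ ∃ F : Quot rel ≃ Quotient s,
      ∀ S a, Inv S a → F (Quot.mk _ S) = Quotient.mk _ a := by
  choose l hl using h1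
  have hr : ∀ S T, rel S T ↔ s (l S) (l T) := fun S T => h3 S T _ _ (hl S) (hl T)
  have heq : Equivalence rel := ⟨fun S => (hr S S).2 (s.refl _),
    fun {S T} h => (hr T S).2 (s.symm ((hr S T).1 h)),
    fun {S T K} h h' => (hr S K).2 (s.trans ((hr S T).1 h) ((hr T K).1 h'))⟩
  -- Comparing `S` with itself shows that all invariants of `S` are equivalent, so the choice `l`
  -- does not matter.
  have hInv : ∀ S a, Inv S a → s (l S) a := fun S a h => (h3 S S _ _ (hl S) h).1 (heq.refl S)
  let f : Quot rel → Quotient s :=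
    Quot.lift (fun S => Quotient.mk s (l S)) fun S T h => Quotient.sound ((hr S T).1 h)
  have hf : Function.Bijective f := by
    constructor
    · rintro ⟨S⟩ ⟨T⟩ h
      exact Quot.sound ((hr S T).2 (Quotient.exact h))
    · rintro ⟨a⟩
      obtain ⟨S, hS⟩ := h2 a
      exact ⟨Quot.mk _ S, Quotient.sound (hInv S a hS)⟩
  exact ⟨heq, Equiv.ofBijective f hf, fun S a h => Quotient.sound (hInv S a h)⟩

/-- The Christoffel symbols in the same orbit under the subgroup `H`. -/
def Christoffel.orbitSetoid (H : Subgroup GLTwo) : Setoid Christoffel where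
  r Γ Γ' := ∃ g ∈ H, Γ' = g • Γ
  iseqv :=
    { refl := fun Γ => ⟨1, H.one_mem, (one_smul _ Γ).symm⟩
      symm := by
        rintro Γ Γ' ⟨g, hg, rfl⟩
        exact ⟨g⁻¹, H.inv_mem hg, (inv_smul_smul g Γ).symm⟩
      trans := by
        rintro Γ Γ' Γ'' ⟨g, hg, rfl⟩ ⟨h, hh, rfl⟩
        exact ⟨h * g, H.mul_mem hh hg, (mul_smul h g Γ).symm⟩ }

/-! ### Unoriented classification and Jacobians -/

namespace AffineSurface

variable {S T K : AffineSurface} {φ : OpenPartialHomeomorph S.carrier T.carrier}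
  {χ : OpenPartialHomeomorph T.carrier K.carrier}
  {e e' : OpenPartialHomeomorph S.carrier Plane} {f f' : OpenPartialHomeomorph T.carrier Plane}
  {h : OpenPartialHomeomorph K.carrier Plane} {p q : ℕ}

theorem orbitSetoid_top_of_isTypeAChart (hA : S.IsTypeA) (hS : S.HasRicciSignature p q)
    {Γ Γ' : Christoffel} (he : S.IsTypeAChart e Γ) (he' : S.IsTypeAChart e' Γ')
    (hne : e.source.Nonempty) (hne' : e'.source.Nonempty) :
    Christoffel.orbitSetoid ⊤ Γ Γ' := by
  refine setoid_of_overlap (X := S.carrier) (Christoffel.orbitSetoid ⊤)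
    (fun e : OpenPartialHomeomorph S.carrier Plane => e.source) (fun e => e.open_source)
    (fun e Γ => S.IsTypeAChart e Γ) hA ?_ he he' hne hne'
  intro e e' Γ Γ' x he he' hx hx'
  obtain ⟨g, -, hg⟩ := exists_smul_eq_of_mem_source hS he he' hx hx'
  exact ⟨g, Subgroup.mem_top g, hg⟩

theorem locallyIsomorphic_iff (hA : S.IsTypeA) (hS : S.HasRicciSignature p q) (hB : T.IsTypeA)
    (hT : T.HasRicciSignature p q) {Γ Γ' : Christoffel} (he : S.IsTypeAChart e Γ)
    (hf : T.IsTypeAChart f Γ') (hne : e.source.Nonempty) (hne' : f.source.Nonempty) :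
    S.LocallyIsomorphic T ↔ Christoffel.orbitSetoid ⊤ Γ Γ' := by
  constructor
  · intro h
    obtain ⟨P, hP⟩ := hne
    obtain ⟨Q, hQ⟩ := hne'
    obtain ⟨φ, hPφ, rfl, hφ⟩ := h P Q
    obtain ⟨g, -, hg⟩ := hφ.exists_smul_eq he hf (hf.mem_W ⟨_, hQ⟩ hT) hP hPφ hQ
    exact ⟨g, Subgroup.mem_top g, hg⟩
  · intro h P Q
    obtain ⟨e₁, Γ₁, hP, he₁⟩ := hA P
    obtain ⟨f₁, Γ₂, hQ, hf₁⟩ := hB Q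
    -- The charts at `P` and `Q` need not be the given `e` and `f`; the orbits are joined through
    -- those two.
    obtain ⟨g, -, rfl⟩ := (Christoffel.orbitSetoid ⊤).trans ((Christoffel.orbitSetoid ⊤).trans
      (orbitSetoid_top_of_isTypeAChart hA hS he₁ he ⟨P, hP⟩ hne) h)
      (orbitSetoid_top_of_isTypeAChart hB hT hf hf₁ hne' ⟨Q, hQ⟩)
    exact ⟨affineGlue e₁ f₁ g P Q, mem_affineGlue_source hP hQ, affineGlue_base hQ,
      isAffineDiffeo_affineGlue he₁ hf₁ P Q⟩

/-- The Jacobian determinant at `x` of `φ` in the charts `e` and `f`. -/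
noncomputable def jacobian (φ : OpenPartialHomeomorph S.carrier T.carrier)
    (e : OpenPartialHomeomorph S.carrier Plane) (f : OpenPartialHomeomorph T.carrier Plane)
    (x : S.carrier) : ℝ :=
  (fderiv ℝ (inCharts φ e f) (e x)).det

theorem jacobian_trans (hφ : SmoothOn φ) (hχ : SmoothOn χ) (he : e ∈ S.charts) (hf : f ∈ T.charts)
    (hh : h ∈ K.charts) {x : S.carrier} (hx : x ∈ e.source) (hxφ : x ∈ φ.source)
    (hxf : φ x ∈ f.source) (hxχ : φ x ∈ χ.source) (hxh : χ (φ x) ∈ h.source) :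
    jacobian (φ.trans χ) e h x = jacobian χ f h (φ x) * jacobian φ e f x := by
  have key : fderiv ℝ (inCharts (φ.trans χ) e h) (e x) =
      fderiv ℝ (inCharts χ f h) (f (φ x)) ∘L fderiv ℝ (inCharts φ e f) (e x) := by
    ext1 w
    obtain ⟨v, rfl⟩ : ∃ v, S.tangentCoord e x v = w :=
      ((smoothOn_of_mem_charts he).mdifferentiable.mfderiv hx).surjective w
    have hx' : x ∈ (φ.trans χ).source := by simp [hxφ, hxχ]
    rw [fderiv_inCharts (hφ.trans hχ) he hh hx hx' hxh, hφ.mfderiv_trans hχ hxφ hxχ,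
      ContinuousLinearMap.comp_apply, fderiv_inCharts hφ he hf hx hxφ hxf,
      fderiv_inCharts hχ hf hh hxf hxχ hxh]
    rfl
  rw [jacobian, key]
  exact LinearMap.det_comp _ _

theorem jacobian_ne_zero (hφ : SmoothOn φ) (he : e ∈ S.charts) (hf : f ∈ T.charts) {x : S.carrier}
    (hx : x ∈ e.source) (hxφ : x ∈ φ.source) (hxf : φ x ∈ f.source) : jacobian φ e f x ≠ 0 := by
  obtain ⟨J, hJ⟩ := (smoothOn_inCharts hφ he hf).isInvertible_fderiv
    (mem_inCharts_source hx hxφ hxf)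
  rw [jacobian, ← hJ]
  exact (LinearEquiv.isUnit_det' J.toLinearEquiv).ne_zero

theorem eventually_jacobian_pos (hφ : SmoothOn φ) (he : e ∈ S.charts) (hf : f ∈ T.charts)
    {x : S.carrier} (hx : x ∈ e.source) (hxφ : x ∈ φ.source) (hxf : φ x ∈ f.source)
    (hpos : 0 < jacobian φ e f x) : ∀ᶠ y in 𝓝 x, 0 < jacobian φ e f y := by
  have h1 : ContDiffAt ℝ ∞ (fderiv ℝ (inCharts φ e f)) (e x) :=
    ((smoothOn_inCharts hφ he hf).contDiffAt (mem_inCharts_source hx hxφ hxf)).fderiv_right (by simp)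
  have h2 : ContinuousAt (jacobian φ e f) x :=
    (ContinuousLinearMap.continuous_det.continuousAt.comp h1.continuousAt).comp (e.continuousAt hx)
  exact continuousAt_const.eventually_lt h2 hpos

/-- The Jacobian determinant of the change of coordinates from `e` to `e'`. -/
noncomputable def chartJacobian (e e' : OpenPartialHomeomorph S.carrier Plane) (x : S.carrier) : ℝ :=
  jacobian (OpenPartialHomeomorph.refl S.carrier) e e' x

/-- Definitional, so the sign conditions that define orientations are literally statements about
`chartJacobian`. -/
theorem chartJacobian_eq (e e' : OpenPartialHomeomorph S.carrier Plane) (x : S.carrier) :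
    chartJacobian e e' x = (fderiv ℝ (e' ∘ e.symm) (e x)).det := rfl

theorem chartJacobian_trans {e'' : OpenPartialHomeomorph S.carrier Plane} (he : e ∈ S.charts)
    (he' : e' ∈ S.charts) (he'' : e'' ∈ S.charts) {x : S.carrier} (hx : x ∈ e.source)
    (hx' : x ∈ e'.source) (hx'' : x ∈ e''.source) :
    chartJacobian e e'' x = chartJacobian e' e'' x * chartJacobian e e' x := by
  have := jacobian_trans (S := S) (T := S) (K := S) SmoothOn.refl SmoothOn.refl he he' he''
    (x := x) hx trivial hx' trivial hx''
  rwa [OpenPartialHomeomorph.refl_trans] at this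

theorem chartJacobian_pos_symm (he : e ∈ S.charts) (he' : e' ∈ S.charts) {x : S.carrier}
    (hx : x ∈ e.source) (hx' : x ∈ e'.source) (hpos : 0 < chartJacobian e e' x) :
    0 < chartJacobian e' e x := by
  have h1 := chartJacobian_trans he he he' hx hx hx'
  have h2 := chartJacobian_trans he he' he hx hx' hx
  -- The cocycle rule gives `J(e, e') = J(e, e') J(e, e)`, and the factor `J(e, e')` can be
  -- cancelled.
  have h3 : chartJacobian e e x = 1 := mul_left_cancel₀ hpos.ne' (by rw [← h1, mul_one])
  rw [h3] at h2
  exact pos_of_mul_pos_left (h2 ▸ one_pos) hpos.le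

theorem jacobian_change (hφ : SmoothOn φ) (he : e ∈ S.charts) (he' : e' ∈ S.charts)
    (hf : f ∈ T.charts) (hf' : f' ∈ T.charts) {x : S.carrier} (hx : x ∈ e.source)
    (hx' : x ∈ e'.source) (hxφ : x ∈ φ.source) (hxf : φ x ∈ f.source) (hxf' : φ x ∈ f'.source) :
    jacobian φ e' f' x = chartJacobian f f' (φ x) * (jacobian φ e f x * chartJacobian e' e x) := by
  have h1 := jacobian_trans (S := S) (T := S) (K := T) SmoothOn.refl hφ he' he hf (x := x)
    hx' trivial hx hxφ hxf
  have h2 := jacobian_trans (S := S) (T := T) (K := T) hφ SmoothOn.refl he' hf hf' (x := x)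
    hx' hxφ hxf trivial hxf'
  rw [OpenPartialHomeomorph.refl_trans] at h1
  rw [OpenPartialHomeomorph.trans_refl, h1] at h2
  exact h2

theorem chartJacobian_trans_planeAffine (g : GLTwo) {x : S.carrier}
    (hx : x ∈ e.source) :
    chartJacobian e (e.trans (planeAffine g 0 0).toOpenPartialHomeomorph) x =
      (g : Matrix (Fin 2) (Fin 2) ℝ).det := by
  rw [chartJacobian_eq, ← GLTwo.toCLM_det]
  congr 1
  refine ((hasFDerivAt_planeAffine g 0 0 (e x)).congr_of_eventuallyEq ?_).fderiv
  filter_upwards [e.open_target.mem_nhds (e.map_source hx)] with z hz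
  simp [e.right_inv hz]

end AffineSurface

/-! ### Oriented classification -/

namespace OrientedAffineSurface

open AffineSurface

variable {S T : OrientedAffineSurface} {e e' : OpenPartialHomeomorph S.carrier Plane}
  {f : OpenPartialHomeomorph T.carrier Plane} {p q : ℕ}

theorem exists_negative_gl : ∃ g : GLTwo, (g : Matrix (Fin 2) (Fin 2) ℝ).det < 0 := by
  refine ⟨Matrix.GeneralLinearGroup.mkOfDetNeZero !![-1, 0; 0, 1] (by simp), ?_⟩
  simp [Matrix.GeneralLinearGroup.mkOfDetNeZero]

/-- If a Type 𝒜 chart has the wrong sign at `P`, a linear map of negative determinant corrects it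
without losing constancy of the symbols. Positivity then persists near `P`, by continuity of the
Jacobian. -/
theorem exists_positive_isTypeAChart (hA : S.IsTypeA) (P : S.carrier) :
    ∃ e Γ, P ∈ e.source ∧ S.IsTypeAChart e Γ ∧ S.IsPositiveChart e := by
  obtain ⟨e₁, he₁, hP₁⟩ := S.orientedAtlas_cover P
  have hc₁ := S.orientedAtlas_subset he₁
  have h1 : ∃ e Γ, P ∈ e.source ∧ S.IsTypeAChart e Γ ∧ 0 < chartJacobian e e₁ P := by
    obtain ⟨e, Γ, hP, he⟩ := hA P
    rcases lt_or_gt_of_ne (jacobian_ne_zero (S := S.toAffineSurface) SmoothOn.refl he.1 hc₁ hP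
      (Set.mem_univ P) hP₁) with hneg | hpos
    · obtain ⟨g, hg⟩ := exists_negative_gl
      have he' := he.trans_affine g
      have hP' : P ∈ (e.trans (planeAffine g 0 0).toOpenPartialHomeomorph).source := by simpa using hP
      refine ⟨_, _, hP', he', ?_⟩
      have h2 := chartJacobian_trans he.1 he'.1 hc₁ hP hP' hP₁
      rw [chartJacobian_trans_planeAffine g hP] at h2
      have h3 : chartJacobian e e₁ P < 0 := hneg
      rw [h2] at h3
      exact pos_of_mul_neg_left h3 hg.le
    · exact ⟨e, Γ, hP, he, hpos⟩
  obtain ⟨e, Γ, hP, he, hpos⟩ := h1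
  obtain ⟨U, hU, hUo, hPU⟩ := eventually_nhds_iff.1 (eventually_jacobian_pos
    (S := S.toAffineSurface) SmoothOn.refl he.1 hc₁ hP (Set.mem_univ P) hP₁ hpos)
  have hUo' := hUo.inter e₁.open_source
  -- Shrinking also into the domain of `e₁` allows comparison with every other atlas chart by way of
  -- `e₁`.
  refine ⟨e.restrOpen (U ∩ e₁.source) hUo', Γ, by simp [hP, hPU, hP₁], he.restr hUo', ?_⟩
  rintro e' he' x ⟨hx, hx'⟩
  simp at hx
  have h2 := chartJacobian_trans he.1 hc₁ (S.orientedAtlas_subset he') hx.1 hx.2.2 hx'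
  have h3 : 0 < chartJacobian e e' x := by
    rw [h2]
    exact mul_pos (S.orientedAtlas_compat e₁ he₁ e' he' x ⟨hx.2.2, hx'⟩) (hU x hx.2.1)
  exact h3

theorem preservesOrientation_refl (S : OrientedAffineSurface) :
    PreservesOrientation S S (OpenPartialHomeomorph.refl S.carrier) :=
  fun e he e' he' x _ hx hx' => S.orientedAtlas_compat e he e' he' x ⟨hx, hx'⟩

/-- Preservation of orientation is stated for atlas charts only; the Jacobian in positive charts
differs from it by two positive transition factors. -/
theorem jacobian_pos {φ : OpenPartialHomeomorph S.carrier T.carrier} (hφ : SmoothOn φ)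
    (ho : PreservesOrientation S T φ) (he : e ∈ S.charts) (hf : f ∈ T.charts)
    (hpe : S.IsPositiveChart e) (hpf : T.IsPositiveChart f) {x : S.carrier} (hx : x ∈ e.source)
    (hxφ : x ∈ φ.source) (hxf : φ x ∈ f.source) :
    0 < jacobian (S := S.toAffineSurface) (T := T.toAffineSurface) φ e f x := by
  obtain ⟨e₁, he₁, hx₁⟩ := S.orientedAtlas_cover x
  obtain ⟨f₁, hf₁, hxf₁⟩ := T.orientedAtlas_cover (φ x)
  have hce := S.orientedAtlas_subset he₁
  have hcf := T.orientedAtlas_subset hf₁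
  rw [jacobian_change (S := S.toAffineSurface) (T := T.toAffineSurface) hφ hce he hcf hf hx₁ hx hxφ
    hxf₁ hxf]
  exact mul_pos (chartJacobian_pos_symm hf hcf hxf hxf₁ (hpf f₁ hf₁ _ ⟨hxf, hxf₁⟩))
    (mul_pos (ho e₁ he₁ f₁ hf₁ x hxφ hx₁ hxf₁) (hpe e₁ he₁ x ⟨hx, hx₁⟩))

theorem preservesOrientation_of_jacobian_pos {φ : OpenPartialHomeomorph S.carrier T.carrier}
    (hφ : SmoothOn φ) (he : e ∈ S.charts) (hf : f ∈ T.charts)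
    (hpe : S.IsPositiveChart e) (hpf : T.IsPositiveChart f)
    (hsrc : ∀ x ∈ φ.source, x ∈ e.source ∧ φ x ∈ f.source)
    (hpos : ∀ x ∈ φ.source,
      0 < jacobian (S := S.toAffineSurface) (T := T.toAffineSurface) φ e f x) :
    PreservesOrientation S T φ := by
  intro e₁ he₁ f₁ hf₁ x hxφ hx₁ hxf₁
  have hce := S.orientedAtlas_subset he₁
  have hcf := T.orientedAtlas_subset hf₁
  obtain ⟨hx, hxf⟩ := hsrc x hxφ
  have h := jacobian_change (S := S.toAffineSurface) (T := T.toAffineSurface) hφ he hce hf hcf hx hx₁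
    hxφ hxf hxf₁
  have h' : 0 < jacobian (S := S.toAffineSurface) (T := T.toAffineSurface) φ e₁ f₁ x := by
    rw [h]
    exact mul_pos (hpf f₁ hf₁ _ ⟨hxf, hxf₁⟩)
      (mul_pos (hpos x hxφ) (chartJacobian_pos_symm he hce hx hx₁ (hpe e₁ he₁ x ⟨hx, hx₁⟩)))
  exact h'

theorem orbitSetoid_of_isAffineDiffeo {φ : OpenPartialHomeomorph S.carrier T.carrier}
    (hφ : IsAffineDiffeo S.toAffineSurface T.toAffineSurface φ) (ho : PreservesOrientation S T φ)
    {Γ Γ' : Christoffel} (he : S.IsTypeAChart e Γ) (hf : T.IsTypeAChart f Γ')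
    (hpe : S.IsPositiveChart e) (hpf : T.IsPositiveChart f) (hΓ' : Γ' ∈ Christoffel.W p q)
    {x : S.carrier} (hx : x ∈ e.source) (hxφ : x ∈ φ.source) (hxf : φ x ∈ f.source) :
    Christoffel.orbitSetoid GLTwoPos Γ Γ' := by
  obtain ⟨g, hg, h⟩ := hφ.exists_smul_eq he hf hΓ' hx hxφ hxf
  refine ⟨g, ?_, h⟩
  have := jacobian_pos hφ.smoothOn ho he.1 hf.1 hpe hpf hx hxφ hxf
  rw [jacobian, ← hg, GLTwo.toCLM_det] at this
  exact this

theorem orbitSetoid_of_isTypeAChart (hA : S.IsTypeA) (hS : S.HasRicciSignature p q)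
    {Γ Γ' : Christoffel} (he : S.IsTypeAChart e Γ) (he' : S.IsTypeAChart e' Γ')
    (hp : S.IsPositiveChart e) (hp' : S.IsPositiveChart e')
    (hne : e.source.Nonempty) (hne' : e'.source.Nonempty) :
    Christoffel.orbitSetoid GLTwoPos Γ Γ' := by
  refine setoid_of_overlap (X := S.carrier) (Christoffel.orbitSetoid GLTwoPos)
    (fun e : OpenPartialHomeomorph S.carrier Plane => e.source) (fun e => e.open_source)
    (fun e Γ => S.IsTypeAChart e Γ ∧ S.IsPositiveChart e) (exists_positive_isTypeAChart hA) ?_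
    ⟨he, hp⟩ ⟨he', hp'⟩ hne hne'
  intro e e' Γ Γ' x he he' hx hx'
  exact orbitSetoid_of_isAffineDiffeo (isAffineDiffeo_refl S.toAffineSurface)
    (preservesOrientation_refl S) he.1 he'.1 he.2 he'.2 (he'.1.mem_W ⟨x, hx'⟩ hS) hx
    (Set.mem_univ x) hx'

theorem locallyIsomorphic_iff (hA : S.IsTypeA) (hS : S.HasRicciSignature p q) (hB : T.IsTypeA)
    (hT : T.HasRicciSignature p q) {Γ Γ' : Christoffel} (he : S.IsTypeAChart e Γ)
    (hf : T.IsTypeAChart f Γ') (hpe : S.IsPositiveChart e) (hpf : T.IsPositiveChart f)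
    (hne : e.source.Nonempty) (hne' : f.source.Nonempty) :
    S.LocallyIsomorphic T ↔ Christoffel.orbitSetoid GLTwoPos Γ Γ' := by
  constructor
  · intro h
    obtain ⟨P, hP⟩ := hne
    obtain ⟨Q, hQ⟩ := hne'
    obtain ⟨φ, hPφ, rfl, hφ, ho⟩ := h P Q
    exact orbitSetoid_of_isAffineDiffeo hφ ho he hf hpe hpf (hf.mem_W ⟨_, hQ⟩ hT) hP hPφ hQ
  · intro h P Q
    obtain ⟨e₁, Γ₁, hP, he₁, hpe₁⟩ := exists_positive_isTypeAChart hA P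
    obtain ⟨f₁, Γ₂, hQ, hf₁, hpf₁⟩ := exists_positive_isTypeAChart hB Q
    obtain ⟨g, hg, rfl⟩ := (Christoffel.orbitSetoid GLTwoPos).trans
      ((Christoffel.orbitSetoid GLTwoPos).trans
        (orbitSetoid_of_isTypeAChart hA hS he₁ he hpe₁ hpe ⟨P, hP⟩ hne) h)
      (orbitSetoid_of_isTypeAChart hB hT hf hf₁ hpf hpf₁ hne' ⟨Q, hQ⟩)
    refine ⟨affineGlue e₁ f₁ g P Q, mem_affineGlue_source hP hQ, affineGlue_base hQ,
      isAffineDiffeo_affineGlue he₁ hf₁ P Q,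
      preservesOrientation_of_jacobian_pos (smoothOn_affineGlue he₁.1 hf₁.1 g P Q) he₁.1 hf₁.1 hpe₁
        hpf₁ (fun x hx => ⟨(of_mem_affineGlue_source hx).1,
          f₁.map_target (of_mem_affineGlue_source hx).2⟩) fun x hx => ?_⟩
    rw [jacobian, fderiv_inCharts_affineGlue hx, GLTwo.toCLM_det]
    exact hg

end OrientedAffineSurface

/-! ### Oriented models and assembly of the four cases -/

/-- The plane with constant Christoffel symbols and its standard orientation. -/
noncomputable def Christoffel.orientedSurface (Γ : Christoffel) : OrientedAffineSurface where
  toAffineSurface := Γ.surface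
  orientedAtlas := {OpenPartialHomeomorph.refl Plane}
  orientedAtlas_subset := by
    rintro e rfl
    exact Γ.surface_isTypeAChart.1
  orientedAtlas_cover x := ⟨_, rfl, Set.mem_univ x⟩
  orientedAtlas_compat := by
    rintro e rfl e' rfl x -
    have : fderiv ℝ (OpenPartialHomeomorph.refl Plane ∘ (OpenPartialHomeomorph.refl Plane).symm)
        (OpenPartialHomeomorph.refl Plane x) = ContinuousLinearMap.id ℝ Plane := fderiv_id
    refine lt_of_lt_of_eq one_pos ((congrArg ContinuousLinearMap.det this).trans ?_).symm
    exact LinearMap.det_id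

theorem Christoffel.orientedSurface_isPositiveChart (Γ : Christoffel) :
    Γ.orientedSurface.IsPositiveChart (OpenPartialHomeomorph.refl Plane) :=
  fun e' he' x hx => Γ.orientedSurface.orientedAtlas_compat _ rfl e' he' x hx

theorem theorem1p2 (p q : ℕ) (hpq : p + q = 2) :
    (Equivalence (StructZPlus.rel (p := p) (q := q)) ∧
      ∃ F : ModuliZPlus p q ≃ MulAction.orbitRel.Quotient GLTwoPos (Christoffel.Z p q),
        ∀ (S : StructZPlus p q) (e : OpenPartialHomeomorph S.1.carrier Plane) (Γ : Christoffel),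
          e.source.Nonempty → S.1.IsTypeAChart e Γ → S.1.IsPositiveChart e →
            ∃ hΓ : Γ ∈ Christoffel.Z p q, F (Quot.mk _ S) = Quotient.mk _ ⟨Γ, hΓ⟩) ∧
    (Equivalence (StructWPlus.rel (p := p) (q := q)) ∧
      ∃ F : ModuliWPlus p q ≃ MulAction.orbitRel.Quotient GLTwoPos (Christoffel.W p q),
        ∀ (S : StructWPlus p q) (e : OpenPartialHomeomorph S.1.carrier Plane) (Γ : Christoffel),
          e.source.Nonempty → S.1.IsTypeAChart e Γ → S.1.IsPositiveChart e →
            ∃ hΓ : Γ ∈ Christoffel.W p q, F (Quot.mk _ S) = Quotient.mk _ ⟨Γ, hΓ⟩) ∧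
    (Equivalence (StructZ.rel (p := p) (q := q)) ∧
      ∃ F : ModuliZ p q ≃ MulAction.orbitRel.Quotient GLTwo (Christoffel.Z p q),
        ∀ (S : StructZ p q) (e : OpenPartialHomeomorph S.1.carrier Plane) (Γ : Christoffel),
          e.source.Nonempty → S.1.IsTypeAChart e Γ →
            ∃ hΓ : Γ ∈ Christoffel.Z p q, F (Quot.mk _ S) = Quotient.mk _ ⟨Γ, hΓ⟩) ∧
    (Equivalence (StructW.rel (p := p) (q := q)) ∧
      ∃ F : ModuliW p q ≃ MulAction.orbitRel.Quotient GLTwo (Christoffel.W p q),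
        ∀ (S : StructW p q) (e : OpenPartialHomeomorph S.1.carrier Plane) (Γ : Christoffel),
          e.source.Nonempty → S.1.IsTypeAChart e Γ →
            ∃ hΓ : Γ ∈ Christoffel.W p q, F (Quot.mk _ S) = Quotient.mk _ ⟨Γ, hΓ⟩)
   := by
  -- `orbitRel` relates `Γ` to `Γ'` when `Γ` lies in the orbit of `Γ'`, the reverse of the
  -- convention in `orbitSetoid`; hence the use of `comm'`.
  have top : ∀ {X : Set Christoffel} [MulAction GLTwo X] (_ : ∀ (g : GLTwo) (Γ : X), (g • Γ).1 = g • Γ.1)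
      (Γ Γ' : X), Christoffel.orbitSetoid ⊤ Γ.1 Γ'.1 ↔ MulAction.orbitRel GLTwo X Γ Γ' := by
    intro X _ hX Γ Γ'
    refine Iff.trans ?_ ((MulAction.orbitRel GLTwo X).comm' (x := Γ') (y := Γ))
    constructor
    · rintro ⟨g, -, h⟩
      exact ⟨g, Subtype.ext ((hX g Γ).trans h.symm)⟩
    · rintro ⟨g, h⟩
      exact ⟨g, Subgroup.mem_top g, by rw [← hX, ← h]⟩
  have pos : ∀ {X : Set Christoffel} [MulAction GLTwo X] (_ : ∀ (g : GLTwo) (Γ : X), (g • Γ).1 = g • Γ.1)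
      (Γ Γ' : X), Christoffel.orbitSetoid GLTwoPos Γ.1 Γ'.1 ↔ MulAction.orbitRel GLTwoPos X Γ Γ' := by
    intro X _ hX Γ Γ'
    refine Iff.trans ?_ ((MulAction.orbitRel GLTwoPos X).comm' (x := Γ') (y := Γ))
    constructor
    · rintro ⟨g, hg, h⟩
      exact ⟨⟨g, hg⟩, Subtype.ext ((hX g Γ).trans h.symm)⟩
    · rintro ⟨g, h⟩
      exact ⟨g.1, g.2, by rw [← hX, ← h]; rfl⟩
  refine ⟨?_, ?_, ?_, ?_⟩
  · obtain ⟨h, F, hF⟩ := exists_equiv_of_invariant (rel := StructZPlus.rel (p := p) (q := q))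
      (MulAction.orbitRel GLTwoPos (Christoffel.Z p q))
      -- The invariant relates `S` to the symbols of each of its positive charts. Non-emptiness of
      -- the domain matters: a smooth chart with empty domain would be a Type 𝒜 chart for every `Γ`.
      (fun S a => ∃ e, e.source.Nonempty ∧ S.1.IsTypeAChart e a.1 ∧ S.1.IsPositiveChart e)
      (fun S => by
        -- A connected space is non-empty, so some chart with non-empty domain exists.
        obtain ⟨P⟩ : Nonempty S.1.carrier := inferInstance
        obtain ⟨e, Γ, hP, he, hp⟩ := OrientedAffineSurface.exists_positive_isTypeAChart S.2.1 P
        exact ⟨⟨Γ, he.mem_W ⟨P, hP⟩ S.2.2.1, he.symm_of_isTorsionFree ⟨P, hP⟩ S.2.2.2⟩, e, ⟨P, hP⟩, he, hp⟩)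
      (fun Γ => ⟨⟨Γ.1.orientedSurface, Γ.1.surface_isTypeA,
        Christoffel.surface_hasRicciSignature Γ.2.1, Christoffel.surface_isTorsionFree Γ.2.2⟩,
        OpenPartialHomeomorph.refl Plane, ⟨(0 : Plane), Set.mem_univ _⟩, Γ.1.surface_isTypeAChart,
        Γ.1.orientedSurface_isPositiveChart⟩)
      (fun S T a b ⟨e, hne, he, hpe⟩ ⟨f, hne', hf, hpf⟩ =>
        (OrientedAffineSurface.locallyIsomorphic_iff S.2.1 S.2.2.1 T.2.1 T.2.2.1 he hf hpe hpf hne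
          hne').trans (pos (fun _ _ => rfl) a b))
    refine ⟨h, F, fun S e Γ hne he hp => ?_⟩
    have hΓ : Γ ∈ Christoffel.Z p q := ⟨he.mem_W hne S.2.2.1, he.symm_of_isTorsionFree hne S.2.2.2⟩
    exact ⟨hΓ, hF S ⟨Γ, hΓ⟩ ⟨e, hne, he, hp⟩⟩
  · obtain ⟨h, F, hF⟩ := exists_equiv_of_invariant (rel := StructWPlus.rel (p := p) (q := q))
      (MulAction.orbitRel GLTwoPos (Christoffel.W p q))
      (fun S a => ∃ e, e.source.Nonempty ∧ S.1.IsTypeAChart e a.1 ∧ S.1.IsPositiveChart e)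
      (fun S => by
        obtain ⟨P⟩ : Nonempty S.1.carrier := inferInstance
        obtain ⟨e, Γ, hP, he, hp⟩ := OrientedAffineSurface.exists_positive_isTypeAChart S.2.1 P
        exact ⟨⟨Γ, he.mem_W ⟨P, hP⟩ S.2.2⟩, e, ⟨P, hP⟩, he, hp⟩)
      (fun Γ => ⟨⟨Γ.1.orientedSurface, Γ.1.surface_isTypeA,
        Christoffel.surface_hasRicciSignature Γ.2⟩,
        OpenPartialHomeomorph.refl Plane, ⟨(0 : Plane), Set.mem_univ _⟩, Γ.1.surface_isTypeAChart,
        Γ.1.orientedSurface_isPositiveChart⟩)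
      (fun S T a b ⟨e, hne, he, hpe⟩ ⟨f, hne', hf, hpf⟩ =>
        (OrientedAffineSurface.locallyIsomorphic_iff S.2.1 S.2.2 T.2.1 T.2.2 he hf hpe hpf hne
          hne').trans (pos (fun _ _ => rfl) a b))
    refine ⟨h, F, fun S e Γ hne he hp => ?_⟩
    have hΓ : Γ ∈ Christoffel.W p q := he.mem_W hne S.2.2
    exact ⟨hΓ, hF S ⟨Γ, hΓ⟩ ⟨e, hne, he, hp⟩⟩
  · obtain ⟨h, F, hF⟩ := exists_equiv_of_invariant (rel := StructZ.rel (p := p) (q := q))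
      (MulAction.orbitRel GLTwo (Christoffel.Z p q))
      (fun S a => ∃ e, e.source.Nonempty ∧ S.1.IsTypeAChart e a.1)
      (fun S => by
        obtain ⟨P⟩ : Nonempty S.1.carrier := inferInstance
        obtain ⟨e, Γ, hP, he⟩ := S.2.1 P
        exact ⟨⟨Γ, he.mem_W ⟨P, hP⟩ S.2.2.1, he.symm_of_isTorsionFree ⟨P, hP⟩ S.2.2.2⟩, e, ⟨P, hP⟩, he⟩)
      (fun Γ => ⟨⟨Γ.1.surface, Γ.1.surface_isTypeA,
        Christoffel.surface_hasRicciSignature Γ.2.1, Christoffel.surface_isTorsionFree Γ.2.2⟩,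
        OpenPartialHomeomorph.refl Plane, ⟨(0 : Plane), Set.mem_univ _⟩, Γ.1.surface_isTypeAChart⟩)
      (fun S T a b ⟨e, hne, he⟩ ⟨f, hne', hf⟩ =>
        (AffineSurface.locallyIsomorphic_iff S.2.1 S.2.2.1 T.2.1 T.2.2.1 he hf hne
          hne').trans (top (fun _ _ => rfl) a b))
    refine ⟨h, F, fun S e Γ hne he => ?_⟩
    have hΓ : Γ ∈ Christoffel.Z p q := ⟨he.mem_W hne S.2.2.1, he.symm_of_isTorsionFree hne S.2.2.2⟩
    exact ⟨hΓ, hF S ⟨Γ, hΓ⟩ ⟨e, hne, he⟩⟩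
  · obtain ⟨h, F, hF⟩ := exists_equiv_of_invariant (rel := StructW.rel (p := p) (q := q))
      (MulAction.orbitRel GLTwo (Christoffel.W p q))
      (fun S a => ∃ e, e.source.Nonempty ∧ S.1.IsTypeAChart e a.1)
      (fun S => by
        obtain ⟨P⟩ : Nonempty S.1.carrier := inferInstance
        obtain ⟨e, Γ, hP, he⟩ := S.2.1 P
        exact ⟨⟨Γ, he.mem_W ⟨P, hP⟩ S.2.2⟩, e, ⟨P, hP⟩, he⟩)
      (fun Γ => ⟨⟨Γ.1.surface, Γ.1.surface_isTypeA, Christoffel.surface_hasRicciSignature Γ.2⟩,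
        OpenPartialHomeomorph.refl Plane, ⟨(0 : Plane), Set.mem_univ _⟩, Γ.1.surface_isTypeAChart⟩)
      (fun S T a b ⟨e, hne, he⟩ ⟨f, hne', hf⟩ =>
        (AffineSurface.locallyIsomorphic_iff S.2.1 S.2.2 T.2.1 T.2.2 he hf hne
          hne').trans (top (fun _ _ => rfl) a b))
    refine ⟨h, F, fun S e Γ hne he => ?_⟩
    have hΓ : Γ ∈ Christoffel.W p q := he.mem_W hne S.2.2
    exact ⟨hΓ, hF S ⟨Γ, hΓ⟩ ⟨e, hne, he⟩⟩
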